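/- Let $s=0$, and consider either of the following two settings. (Gaussian random walks) $V_1,V_2,\ldots$ and $W_1,W_2,\ldots$ are two independent sequences of independent standard Gaussian random variables, and $X_0=Y_0=0$, $X_t=st+\sum_{i=1}^t V_i$, $Y_t=X_t+\varepsilon\sum_{i=1}^t W_i$ for integers $t\ge 1$. (Brownian motions) $(B_t)_{t\ge 0}$ and $(N_t)_{t\ge 0}$ are two independent standard Brownian motions, and $X_t=B_t+st$, $Y_t=X_t+\varepsilon N_t$ for real $t\ge 0$. For $l>0$ let $\tau_l=\inf\{t\ge 0: X_t\ge l\}$, where $t$ ranges over the integers in the first setting and over the reals in the second, and $\inf\emptyset=\infty$. An estimator $\eta=\eta(Y_0^\infty)$ is a (possibly extended-real-valued) measurable function of the entire trajectory $Y_0^\infty=(Y_t)_{t\ge 0}$ of the observation process; it need not be a stopping time. A non-decreasing function on $[0,\infty)$ is extended to $\infty$ by its limit. Then, in each of the two settings: (i) Let $f:[0,\infty)\to[0,\infty)$ be a non-decreasing function such that $$\mathbb{E}\, f(\tau_h/2)=\infty\qquad(*)$$ for some constant $h>0$. Then $\mathbb{E}\, f(|\tau_l-\eta|)=\infty$ for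 every estimator $\eta=\eta(Y_0^\infty)$, whenever $\varepsilon>0$ and $l>0$. (ii) If $f(x)=x^r$ with $r\ge 1/2$, then $(*)$ holds for all $h>0$. Hence $\mathbb{E}\,|\tau_l-\eta|^r=\infty$ for every estimator $\eta=\eta(Y_0^\infty)$ of $\tau_l$, whenever $r\ge 1/2$, $\varepsilon>0$ and $l>0$. -/

import Mathlib

open MeasureTheory ProbabilityTheory
open scoped ENNReal NNReal

noncomputable section

namespace ThresholdTracking

variable {Ω : Type*} [MeasurableSpace Ω]

/-- `V` and `W` are two independent sequences of independent standard Gaussian random variables.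
The entry of index `i` of a sequence is the step number `i + 1` of the random walk it drives. -/
structure IsGaussianStepPair (V W : ℕ → Ω → ℝ) (P : Measure Ω) : Prop where
  measurable_left : ∀ i, Measurable (V i)
  measurable_right : ∀ i, Measurable (W i)
  hasLaw_left : ∀ i, HasLaw (V i) (gaussianReal 0 1) P
  hasLaw_right : ∀ i, HasLaw (W i) (gaussianReal 0 1) P
  indep_left : iIndepFun V P
  indep_right : iIndepFun W P
  indep : IndepFun (fun ω i ↦ V i ω) (fun ω i ↦ W i ω) P

/-- `B` and `N` are two independent standard Brownian motions. -/
structure IsBrownianPair (B N : ℝ≥0 → Ω → ℝ) (P : Measure Ω) : Prop where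
  measurable_left : ∀ t, Measurable (B t)
  measurable_right : ∀ t, Measurable (N t)
  left : IsBrownianReal B P
  right : IsBrownianReal N P
  indep : IndepFun (fun ω t ↦ B t ω) (fun ω t ↦ N t ω) P

/-- The sums `V 0 + ⋯ + V (t - 1)` of the first `t` steps. -/
def partialSum (V : ℕ → Ω → ℝ) (t : ℕ) (ω : Ω) : ℝ :=
  ∑ i ∈ Finset.range t, V i ω

/-- The random walk with steps `V` and drift `s`, started at `0`. -/
def walk (s : ℝ) (V : ℕ → Ω → ℝ) (t : ℕ) (ω : Ω) : ℝ :=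
  partialSum V t ω + s * t

/-- Brownian motion with drift `s`. -/
def driftedBM (s : ℝ) (B : ℝ≥0 → Ω → ℝ) (t : ℝ≥0) (ω : Ω) : ℝ :=
  B t ω + s * t

/-- The noisy observation `Y = X + ε N` of the process `X`. -/
def observation {ι : Type*} (ε : ℝ) (X N : ι → Ω → ℝ) (t : ι) (ω : Ω) : ℝ :=
  X t ω + ε * N t ω

/-- The crossing time `inf {t : X t ≥ l}` of a discrete-time process (`∞` if there is none). -/
def crossingNat (X : ℕ → Ω → ℝ) (l : ℝ) (ω : Ω) : ℝ≥0∞ :=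
  ⨅ (t : ℕ) (_ : l ≤ X t ω), (t : ℝ≥0∞)

/-- The crossing time `inf {t : X t ≥ l}` of a continuous-time process (`∞` if there is none). -/
def crossingReal (X : ℝ≥0 → Ω → ℝ) (l : ℝ) (ω : Ω) : ℝ≥0∞ :=
  ⨅ (t : ℝ≥0) (_ : l ≤ X t ω), (t : ℝ≥0∞)

/-- `η` is an estimator based on the entire trajectory of `Y`: almost surely it is a measurable
function of that trajectory. Infinite values are allowed. -/
def IsEstimator {ι : Type*} (η : Ω → EReal) (Y : ι → Ω → ℝ) (P : Measure Ω) : Prop :=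
  ∃ g : (ι → ℝ) → EReal, Measurable g ∧ ∀ᵐ ω ∂P, η ω = g (fun t ↦ Y t ω)

/-- The absolute deviation `|τ - η|`, in `[0, ∞]`. -/
def deviation (τ : ℝ≥0∞) (η : EReal) : ℝ≥0∞ := ((τ : EReal) - η).abs

open Classical in
/-- The extension of a non-decreasing `f : [0, ∞) → [0, ∞)` to `[0, ∞]`, the value at `∞`
being `sup f`, the limit of `f` at infinity. -/
def extendTop (f : ℝ≥0 → ℝ≥0) (x : ℝ≥0∞) : ℝ≥0∞ :=
  if x = ∞ then ⨆ y : ℝ≥0, (f y : ℝ≥0∞) else (f x.toNNReal : ℝ≥0∞)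

end ThresholdTracking

end

open ThresholdTracking

/-! The trajectory `Y = B + ε N` cannot distinguish `B` from a mirror image. The reflection of the
plane that fixes the vector `(1, ε)` turns `(B, N)` into a pair `(B', N')` with the same law and
with `B' + ε N' = Y`. Hence an estimator `η(Y)` deviates from the crossing times `τ` of `B` and `τ'`
of `B' = a B + b N` with the same law, while the larger of the two deviations is at least `(τ - τ')
/ 2`. It therefore suffices that `f ((τ - τ') / 2)` has infinite expectation
(`lintegral_deviation_eq_top`).

With positive probability `B` stays below `l` up to some `t₀` and ends at or below `-d`, while `N
t₀` is so large that `B'` has already reached `l`. Then `τ - τ'` is at least the time that the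
restarted process needs to climb `l + d`. That time is independent of the past of `B` and of `N t₀`,
and its loss has infinite mean (`lintegral_hit_sub_hit_eq_top`). The same dip shows that an infinite
mean at one level gives one at every positive level (`lintegral_hit_eq_top`).

For the powers it suffices that `√τ` has infinite mean. Otherwise the values of the process at the
times `4 ^ k`, restricted to survival up to `4 ^ k`, have an integrable majorant and so tend to `0`
in mean. Optional stopping bounds these means below by `h` times the probability of having crossed,
which tends to `h` (`tsum_survival_eq_top`). -/

noncomputable section

namespace ThresholdTracking

/-! ### Laws of Gaussian processes -/

section Gaussian

variable {Ω κ S T : Type*} [MeasurableSpace Ω] {P : Measure Ω}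

/-- Two centred Gaussian processes with the same covariances have the same law. -/
theorem map_eq_of_covariance_eq {X Y : κ → Ω → ℝ} (hX : IsGaussianProcess X P)
    (hY : IsGaussianProcess Y P) (mX : ∀ t, Measurable (X t)) (mY : ∀ t, Measurable (Y t))
    (eX : ∀ t, P[X t] = 0) (eY : ∀ t, P[Y t] = 0)
    (h : ∀ s t, cov[X s, X t; P] = cov[Y s, Y t; P]) :
    P.map (fun ω t ↦ X t ω) = P.map (fun ω t ↦ Y t ω) := by
  have := hX.isProbabilityMeasure
  rw [map_eq_iff_forall_finset_map_restrict_eq (measurable_pi_lambda _ mX).aemeasurable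
    (measurable_pi_lambda _ mY).aemeasurable]
  intro I
  have mX' : AEMeasurable (fun ω ↦ I.restrict (X · ω)) P :=
    (measurable_pi_lambda _ fun _ ↦ mX _).aemeasurable
  have mY' : AEMeasurable (fun ω ↦ I.restrict (Y · ω)) P :=
    (measurable_pi_lambda _ fun _ ↦ mY _).aemeasurable
  -- The criterion by mean and covariance form is stated on inner product spaces, so the
  -- finite-dimensional laws are moved to Euclidean space.
  apply (MeasurableEquiv.toLp 2 (_ → ℝ)).map_measurableEquiv_injective
  rw [MeasurableEquiv.coe_toLp, ← PiLp.coe_symm_continuousLinearEquiv 2 ℝ]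
  have gX := (hX.hasGaussianLaw I).isGaussian_map
  have gY := (hY.hasGaussianLaw I).isGaussian_map
  have key : ∀ Z : κ → Ω → ℝ, IsGaussianProcess Z P →
      AEMeasurable (fun ω ↦ I.restrict (Z · ω)) P → (∀ t, P[Z t] = 0) →
      (∫ x, x ∂(P.map (fun ω ↦ I.restrict (Z · ω))) = 0) := by
    intro Z hZ mZ eZ
    rw [integral_map mZ (by fun_prop)]
    ext i
    rw [eval_integral]
    · simpa using eZ _
    · exact fun _ ↦ (hZ.hasGaussianLaw_eval _).integrable
  have mL : ∀ ν : Measure (I → ℝ), [IsGaussian ν] → (∫ x, x ∂ν = 0) →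
      ∫ x, id x ∂(ν.map (PiLp.continuousLinearEquiv 2 ℝ (fun _ : I ↦ ℝ)).symm) = 0 := by
    intro ν _ hν
    rw [integral_map (by fun_prop) (by fun_prop)]
    simp only [id_eq]
    rw [ContinuousLinearEquiv.integral_comp_id_comm, hν, map_zero]
  apply IsGaussian.ext
  · rw [mL _ (key X hX mX' eX), mL _ (key Y hY mY' eY)]
  · rw [← ContinuousLinearMap.toBilinForm_inj]
    refine LinearMap.BilinForm.ext_of_isSymm isPosSemidef_covarianceBilin.isSymm
      isPosSemidef_covarianceBilin.isSymm fun x ↦ ?_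
    simp only [ContinuousLinearMap.toBilinForm_apply]
    rw [PiLp.coe_symm_continuousLinearEquiv, covarianceBilin_apply_pi, covarianceBilin_apply_pi]
    · congrm ∑ i, ∑ j, _ * ?_
      rw [covariance_map (measurable_pi_apply _).aestronglyMeasurable
          (measurable_pi_apply _).aestronglyMeasurable mX',
        covariance_map (measurable_pi_apply _).aestronglyMeasurable
          (measurable_pi_apply _).aestronglyMeasurable mY']
      exact h i j
    · exact fun i ↦ ((hY.hasGaussianLaw I).isGaussian_map.hasGaussianLaw_id.eval i).memLp_two
    · exact fun i ↦ ((hX.hasGaussianLaw I).isGaussian_map.hasGaussianLaw_id.eval i).memLp_two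

/-- Two independent Gaussian processes are jointly Gaussian. -/
theorem isGaussianProcess_sumElim {X : S → Ω → ℝ} {Y : T → Ω → ℝ} (hX : IsGaussianProcess X P)
    (hY : IsGaussianProcess Y P) (h : IndepFun (fun ω s ↦ X s ω) (fun ω t ↦ Y t ω) P) :
    IsGaussianProcess (Sum.elim X Y) P where
  hasGaussianLaw I := by
    classical
    let I₁ : Finset S := I.preimage Sum.inl Sum.inl_injective.injOn
    let I₂ : Finset T := I.preimage Sum.inr Sum.inr_injective.injOn
    have h1 := hX.hasGaussianLaw I₁
    have h2 := hY.hasGaussianLaw I₂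
    have h12 := IndepFun.hasGaussianLaw h1 h2
      (h.comp (Finset.measurable_restrict I₁) (Finset.measurable_restrict I₂))
    let f : I → ((I₁ → ℝ) × (I₂ → ℝ)) →L[ℝ] ℝ := fun i ↦ match i with
      | ⟨.inl s, hs⟩ => (ContinuousLinearMap.proj (R := ℝ) (φ := fun _ : I₁ ↦ ℝ)
          ⟨s, by simpa [I₁] using hs⟩).comp (ContinuousLinearMap.fst ℝ _ _)
      | ⟨.inr t, ht⟩ => (ContinuousLinearMap.proj (R := ℝ) (φ := fun _ : I₂ ↦ ℝ)
          ⟨t, by simpa [I₂] using ht⟩).comp (ContinuousLinearMap.snd ℝ _ _)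
    have hf : (fun ω ↦ I.restrict (fun i ↦ Sum.elim X Y i ω)) = ContinuousLinearMap.pi f ∘
        fun ω ↦ (I₁.restrict fun s ↦ X s ω, I₂.restrict fun t ↦ Y t ω) := by
      funext ω i
      obtain ⟨s | t, hs⟩ := i <;> rfl
    rw [hf]
    exact h12.map (ContinuousLinearMap.pi f)

theorem covariance_combination [IsFiniteMeasure P] {f g f' g' : Ω → ℝ} (hf : MemLp f 2 P)
    (hg : MemLp g 2 P) (hf' : MemLp f' 2 P) (hg' : MemLp g' 2 P) (a b a' b' : ℝ) :
    cov[fun ω ↦ a * f ω + b * g ω, fun ω ↦ a' * f' ω + b' * g' ω; P] =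
      a * a' * cov[f, f'; P] + a * b' * cov[f, g'; P] + b * a' * cov[g, f'; P]
        + b * b' * cov[g, g'; P] := by
  have h1 := hf.const_mul a
  have h2 := hg.const_mul b
  have h1' := hf'.const_mul a'
  have h2' := hg'.const_mul b'
  change cov[(fun ω ↦ a * f ω) + (fun ω ↦ b * g ω), (fun ω ↦ a' * f' ω) + (fun ω ↦ b' * g' ω); P]
    = _
  rw [covariance_add_left h1 h2 (h1'.add h2'), covariance_add_right h1 h1' h2',
    covariance_add_right h2 h1' h2']
  simp only [covariance_const_mul_left, covariance_const_mul_right]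
  ring

end Gaussian

/-! ### Walks and Brownian motion in one framework: `ι` is `ℕ` or `ℝ≥0`, and `c` reads time -/

section SampledBM

variable {Ω ι : Type*} [MeasurableSpace Ω] [AddCommMonoid ι] {c : ι →+ ℝ≥0}
  {B N : ι → Ω → ℝ} {P : Measure Ω}

/-- `B` has the finite-dimensional laws of a Brownian motion observed along the clock `c`. -/
structure IsSampledBM (c : ι →+ ℝ≥0) (B : ι → Ω → ℝ) (P : Measure Ω) : Prop where
  measurable : ∀ t, Measurable (B t)
  gaussian : IsGaussianProcess B P
  mean : ∀ t, P[B t] = 0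
  cov : ∀ s t, cov[B s, B t; P] = min (c s : ℝ) (c t)

theorem clock_mono [LinearOrder ι] [CanonicallyOrderedAdd ι] {s t : ι} (h : s ≤ t) :
    (c s : ℝ) ≤ c t := by
  obtain ⟨u, rfl⟩ := exists_add_of_le h
  simp

namespace IsSampledBM

theorem memLp_two (hB : IsSampledBM c B P) (t : ι) : MemLp (B t) 2 P :=
  (hB.gaussian.hasGaussianLaw_eval t).memLp_two

theorem integrable (hB : IsSampledBM c B P) (t : ι) : Integrable (B t) P :=
  (hB.gaussian.hasGaussianLaw_eval t).integrable

theorem isProbabilityMeasure (hB : IsSampledBM c B P) : IsProbabilityMeasure P :=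
  hB.gaussian.isProbabilityMeasure

theorem measurable_path (hB : IsSampledBM c B P) : Measurable fun ω t ↦ B t ω :=
  measurable_pi_lambda _ hB.measurable

theorem shift (hB : IsSampledBM c B P) (t₀ : ι) :
    IsSampledBM c (fun t ω ↦ B (t₀ + t) ω - B t₀ ω) P where
  measurable t := (hB.measurable _).sub (hB.measurable _)
  gaussian := hB.gaussian.shift t₀
  mean t := by
    rw [integral_sub (hB.integrable _) (hB.integrable _), hB.mean, hB.mean, sub_zero]
  cov s t := by
    have := hB.isProbabilityMeasure
    have key := covariance_combination (hB.memLp_two (t₀ + s)) (hB.memLp_two t₀)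
      (hB.memLp_two (t₀ + t)) (hB.memLp_two t₀) 1 (-1) 1 (-1)
    simp only [one_mul, neg_mul, ← sub_eq_add_neg] at key
    rw [key, hB.cov, hB.cov, hB.cov, hB.cov]
    simp [min_add_add_left]

theorem map_shift (hB : IsSampledBM c B P) (t₀ : ι) :
    P.map (fun ω t ↦ B (t₀ + t) ω - B t₀ ω) = P.map (fun ω t ↦ B t ω) :=
  map_eq_of_covariance_eq (hB.shift t₀).gaussian hB.gaussian (hB.shift t₀).measurable hB.measurable
    (hB.shift t₀).mean hB.mean fun s t ↦ by rw [hB.cov]; exact (hB.shift t₀).cov s t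

/-- The joint law of two independent Brownian motions is invariant under the reflections of the
plane. -/
theorem map_reflect (hB : IsSampledBM c B P) (hN : IsSampledBM c N P)
    (h : IndepFun (fun ω t ↦ B t ω) (fun ω t ↦ N t ω) P) {a b : ℝ} (hab : a ^ 2 + b ^ 2 = 1) :
    P.map (fun ω ↦ ((fun t ↦ a * B t ω + b * N t ω), fun t ↦ b * B t ω + -a * N t ω)) =
      P.map (fun ω ↦ ((fun t ↦ B t ω), fun t ↦ N t ω)) := by
  classical
  have := hB.isProbabilityMeasure
  let X : ι ⊕ ι → Ω → ℝ := Sum.elim B N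
  let Y : ι ⊕ ι → Ω → ℝ :=
    Sum.elim (fun t ω ↦ a * B t ω + b * N t ω) (fun t ω ↦ b * B t ω + -a * N t ω)
  have hX : IsGaussianProcess X P := isGaussianProcess_sumElim hB.gaussian hN.gaussian h
  have hY : IsGaussianProcess Y P := by
    apply hX.of_isGaussianProcess
    rintro (t | t)
    · exact ⟨{.inl t, .inr t},
        { toFun x := a * x ⟨.inl t, by simp⟩ + b * x ⟨.inr t, by simp⟩
          map_add' x y := by simp; ring
          map_smul' c x := by simp; ring }, by simp [X, Y]⟩
    · exact ⟨{.inl t, .inr t},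
        { toFun x := b * x ⟨.inl t, by simp⟩ + -a * x ⟨.inr t, by simp⟩
          map_add' x y := by simp; ring
          map_smul' c x := by simp; ring }, by simp [X, Y]⟩
  have mX : ∀ t, Measurable (X t) := by
    rintro (t | t)
    · exact hB.measurable t
    · exact hN.measurable t
  have mY : ∀ t, Measurable (Y t) := by
    rintro (t | t)
    · exact ((hB.measurable t).const_mul a).add ((hN.measurable t).const_mul b)
    · exact ((hB.measurable t).const_mul b).add ((hN.measurable t).const_mul (-a))
  have hcr : ∀ s t, cov[B s, N t; P] = 0 := fun s t ↦
    (h.comp (measurable_pi_apply s) (measurable_pi_apply t)).covariance_eq_zero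
      (hB.memLp_two s) (hN.memLp_two t)
  have hcr' : ∀ s t, cov[N s, B t; P] = 0 := fun s t ↦ by rw [covariance_comm, hcr]
  have key : P.map (fun ω t ↦ Y t ω) = P.map (fun ω t ↦ X t ω) := by
    refine map_eq_of_covariance_eq hY hX mY mX ?_ ?_ ?_
    · rintro (t | t)
      · simp only [Y, Sum.elim_inl]
        rw [integral_add ((hB.integrable _).const_mul a) ((hN.integrable _).const_mul b),
          integral_const_mul, integral_const_mul, hB.mean, hN.mean]
        simp
      · simp only [Y, Sum.elim_inr]
        rw [integral_add ((hB.integrable _).const_mul b) ((hN.integrable _).const_mul (-a)),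
          integral_const_mul, integral_const_mul, hB.mean, hN.mean]
        simp
    · rintro (t | t)
      · exact hB.mean t
      · exact hN.mean t
    · rintro (s | s) (t | t) <;> simp only [X, Y, Sum.elim_inl, Sum.elim_inr] <;>
        rw [covariance_combination (hB.memLp_two _) (hN.memLp_two _) (hB.memLp_two _)
          (hN.memLp_two _)] <;>
        simp only [hcr, hcr', hB.cov, hN.cov]
      -- Equal components get the factor `a ^ 2 + b ^ 2 = 1`; in the mixed cases the terms `a * b`
      -- cancel.
      · linear_combination (min (c s : ℝ) (c t)) * hab
      · ring
      · ring
      · linear_combination (min (c s : ℝ) (c t)) * hab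
  have mφ : Measurable (fun x : ι ⊕ ι → ℝ ↦ ((fun t ↦ x (.inl t)), fun t ↦ x (.inr t))) := by
    fun_prop
  have := congrArg (Measure.map (fun x : ι ⊕ ι → ℝ ↦ ((fun t ↦ x (.inl t)), fun t ↦ x (.inr t)))) key
  rwa [Measure.map_map mφ (measurable_pi_lambda _ mY),
    Measure.map_map mφ (measurable_pi_lambda _ mX)] at this

variable [LinearOrder ι] [CanonicallyOrderedAdd ι]

/-- For `t ≤ t₀` the covariance of an increment after `t₀` with `B t` is `c t - c t = 0`, and
uncorrelated means independent in a jointly Gaussian family. -/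
theorem indepFun_shift (hB : IsSampledBM c B P) (t₀ : ι) :
    IndepFun (fun ω t ↦ B (t₀ + t) ω - B t₀ ω) (fun ω (t : Set.Iic t₀) ↦ B t ω) P := by
  classical
  apply IsGaussianProcess.indepFun_of_covariance_eq_zero
  · apply hB.gaussian.of_isGaussianProcess
    rintro (t | ⟨t, ht⟩)
    · exact ⟨{t₀, t₀ + t},
        { toFun x := x ⟨t₀ + t, by simp⟩ - x ⟨t₀, by simp⟩
          map_add' x y := by simp; abel
          map_smul' c x := by simp; ring }, by simp⟩
    · exact ⟨{t},
        { toFun x := x ⟨t, by simp⟩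
          map_add' x y := by simp
          map_smul' c x := by simp }, by simp⟩
  · exact fun t ↦ ((hB.shift t₀).measurable t).aemeasurable
  · exact fun t ↦ (hB.measurable t).aemeasurable
  · rintro s ⟨t, ht : t ≤ t₀⟩
    have := hB.isProbabilityMeasure
    have h := clock_mono (c := c) ht
    rw [covariance_fun_sub_left (hB.memLp_two _) (hB.memLp_two _) (hB.memLp_two _),
      hB.cov, hB.cov, min_eq_right h, min_eq_right, sub_self]
    rw [map_add, NNReal.coe_add]
    linarith [(c s).2]

end IsSampledBM

end SampledBM

/-! ### Slow decay of survival probabilities and optional stopping -/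

/-- Dyadic summation: `∑ 2 ^ k` over the `k` with `ω ∈ D k` is at most `2 √τ` if `τ ≥ 4 ^ k`
on `D k`. -/
theorem tsum_indicator_le_sqrt {Ω : Type*} {D : ℕ → Set Ω} {τ : Ω → ℝ≥0∞} {ω : Ω}
    (h : ∀ k, ω ∈ D k → (4 : ℝ≥0∞) ^ k ≤ τ ω) :
    ∑' k, (D k).indicator (fun _ ↦ (2 : ℝ≥0∞) ^ k) ω ≤ 2 * τ ω ^ (1 / 2 : ℝ) := by
  have hgeom : ∀ n : ℕ, ∑ k ∈ Finset.range n, (2 : ℝ≥0∞) ^ k ≤ 2 ^ n := by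
    intro n
    induction n with
    | zero => simp
    | succ n ih => rw [Finset.sum_range_succ, pow_succ, mul_two]; gcongr
  have hsum : ∀ n, ∑ k ∈ Finset.range n, (D k).indicator (fun _ ↦ (2 : ℝ≥0∞) ^ k) ω ≤
      2 * τ ω ^ (1 / 2 : ℝ) := by
    intro n
    induction n with
    | zero => simp
    | succ n ih =>
      -- Only the last index that occurs matters: the whole sum up to it is at most `2 ^ (n + 1) = 2
      -- * √(4 ^ n)`.
      by_cases hω : ω ∈ D n
      · calc ∑ k ∈ Finset.range (n + 1), (D k).indicator (fun _ ↦ (2 : ℝ≥0∞) ^ k) ω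
            ≤ ∑ k ∈ Finset.range (n + 1), (2 : ℝ≥0∞) ^ k :=
              Finset.sum_le_sum fun k _ ↦ Set.indicator_le_self' (fun _ _ ↦ zero_le) _
          _ ≤ 2 ^ (n + 1) := hgeom _
          _ = 2 * ((4 : ℝ≥0∞) ^ n) ^ (1 / 2 : ℝ) := by
            have h4 : (4 : ℝ≥0∞) ^ n = (2 ^ n) ^ (2 : ℝ) := by
              rw [ENNReal.rpow_ofNat, ← pow_mul, mul_comm, pow_mul]; norm_num
            rw [h4, ← ENNReal.rpow_mul, pow_succ']
            norm_num
          _ ≤ _ := by gcongr; exact h n hω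
      · rw [Finset.sum_range_succ, Set.indicator_of_notMem hω, add_zero]; exact ih
  rw [ENNReal.tsum_eq_iSup_nat]
  exact iSup_le hsum

section Domination

open Filter Topology

variable {Ω : Type*} [MeasurableSpace Ω] {P : Measure Ω} [IsProbabilityMeasure P]

/-- If the events `D k` are the survival events of a process `S` at the times `4 ^ k`, and
`h` times the probability of non-survival is bounded by the expectation of `|S k|` on `D k`, then
survival probabilities decay slowly. -/
theorem tsum_survival_eq_top {S : ℕ → Ω → ℝ} {D : ℕ → Set Ω} {h : ℝ≥0∞} (hh : h ≠ 0)
    (mS : ∀ k, Measurable (S k)) (mD : ∀ k, MeasurableSet (D k)) (aD : Antitone D)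
    (hS : ∫⁻ ω, ‖S 0 ω‖ₑ ∂P ≠ ∞)
    (hincr : ∀ k, ∫⁻ ω in D k, ‖S (k + 1) ω - S k ω‖ₑ ∂P ≤ 2 * (2 ^ k * P (D k)))
    (hsurv : ∀ k, h * P (D k)ᶜ ≤ ∫⁻ ω in D k, ‖S k ω‖ₑ ∂P) :
    ∑' k, 2 ^ k * P (D k) = ∞ := by
  by_contra hfin
  have hP : Tendsto (fun k ↦ P (D k)) atTop (𝓝 0) := by
    refine tendsto_of_tendsto_of_tendsto_of_le_of_le tendsto_const_nhds
      (ENNReal.tendsto_atTop_zero_of_tsum_ne_top hfin) (fun _ ↦ zero_le) fun k ↦ ?_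
    exact le_mul_of_one_le_left zero_le (one_le_pow₀ one_le_two)
  -- Telescoping along the decreasing events makes `M` a majorant of `|S k|` on every `D k`; if the
  -- series converges, `hincr` makes it integrable.
  let M : Ω → ℝ≥0∞ := fun ω ↦ ‖S 0 ω‖ₑ + ∑' k, (D k).indicator (fun ω ↦ ‖S (k + 1) ω - S k ω‖ₑ) ω
  have hM : ∫⁻ ω, M ω ∂P ≠ ∞ := by
    have hmi : ∀ k, Measurable ((D k).indicator (fun ω ↦ ‖S (k + 1) ω - S k ω‖ₑ)) := fun k ↦
      ((mS (k + 1)).sub (mS k)).enorm.indicator (mD k)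
    rw [lintegral_add_left (mS 0).enorm, lintegral_tsum fun k ↦ (hmi k).aemeasurable]
    refine ENNReal.add_ne_top.2 ⟨hS, ne_top_of_le_ne_top (b := 2 * ∑' k, 2 ^ k * P (D k))
      (ENNReal.mul_ne_top (by simp) hfin) ?_⟩
    rw [← ENNReal.tsum_mul_left]
    refine ENNReal.tsum_le_tsum fun k ↦ ?_
    rw [lintegral_indicator (mD k)]
    exact hincr k
  have hSM : ∀ k, ∀ ω ∈ D k, ‖S k ω‖ₑ ≤ M ω := by
    intro k ω hω
    have hpart : ∀ n ≤ k, ‖S n ω‖ₑ ≤ ‖S 0 ω‖ₑ + ∑ j ∈ Finset.range n,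
        (D j).indicator (fun ω ↦ ‖S (j + 1) ω - S j ω‖ₑ) ω := by
      intro n
      induction n with
      | zero => simp
      | succ n ih =>
        intro hn
        have hmem : ω ∈ D n := aD (by omega : n ≤ k) hω
        rw [Finset.sum_range_succ, Set.indicator_of_mem hmem, ← add_assoc]
        calc ‖S (n + 1) ω‖ₑ = ‖S n ω + (S (n + 1) ω - S n ω)‖ₑ := by congr 1; ring
          _ ≤ ‖S n ω‖ₑ + ‖S (n + 1) ω - S n ω‖ₑ := enorm_add_le _ _
          _ ≤ _ := by gcongr; exact ih (by omega)
    exact (hpart k le_rfl).trans (by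
      simp only [M]; gcongr; exact ENNReal.sum_le_tsum _)
  -- The integrals of one fixed integrable function over events of vanishing probability tend to
  -- `0`, whereas `h * (1 - P (D k))` tends to `h ≠ 0`.
  have hlim : Tendsto (fun k ↦ ∫⁻ ω in D k, M ω ∂P) atTop (𝓝 0) :=
    tendsto_setLIntegral_zero hM hP
  have hle : ∀ k, h * (1 - P (D k)) ≤ ∫⁻ ω in D k, M ω ∂P := by
    intro k
    rw [← prob_compl_eq_one_sub (mD k)]
    exact (hsurv k).trans (setLIntegral_mono' (mD k) (hSM k))
  have hlim' : Tendsto (fun k ↦ h * (1 - P (D k))) atTop (𝓝 (h * (1 - 0))) :=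
    ENNReal.Tendsto.const_mul (ENNReal.Tendsto.sub tendsto_const_nhds hP (by simp)) (by simp)
  have := le_of_tendsto_of_tendsto' hlim' hlim hle
  simp [hh] at this

/-- Optional stopping for the first crossing of `h` by a process with centred increments. -/
theorem mul_prob_crossing_le {X : ℕ → Ω → ℝ} (mX : ∀ i, Measurable (X i))
    (iX : ∀ i, Integrable (X i) P) (eX : ∀ i, P[X i] = 0) (h : ℝ)
    (hincr : ∀ n, ∫ ω in {ω | ∀ i ≤ n, X i ω < h}, (X (n + 1) ω - X n ω) ∂P = 0) (n : ℕ) :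
    ENNReal.ofReal h * P {ω | ∀ i ≤ n, X i ω < h}ᶜ ≤
      ∫⁻ ω in {ω | ∀ i ≤ n, X i ω < h}, ‖X n ω‖ₑ ∂P := by
  set D : ℕ → Set Ω := fun n ↦ {ω | ∀ i ≤ n, X i ω < h} with hD
  have mD : ∀ n, MeasurableSet (D n) := fun n ↦ by
    have : D n = ⋂ i ∈ Set.Iic n, {ω | X i ω < h} := by ext; simp [hD]
    rw [this]
    exact .biInter (Set.to_countable _) fun i _ ↦ measurableSet_lt (mX i) measurable_const
  have hcompl : ∀ (A : Set Ω) i, MeasurableSet A → ∫ ω in Aᶜ, X i ω ∂P = - ∫ ω in A, X i ω ∂P := by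
    intro A i hA
    have := integral_add_compl hA (iX i)
    rw [eX i] at this
    linarith
  -- The process is not stopped: on paths that have crossed, `X n` has the same mean as the value at
  -- crossing, which is at least `h`.
  have key : ∀ n, h * P.real (D n)ᶜ ≤ ∫ ω in (D n)ᶜ, X n ω ∂P := by
    intro n
    induction n with
    | zero =>
      have : ∫ _ in (D 0)ᶜ, h ∂P ≤ ∫ ω in (D 0)ᶜ, X 0 ω ∂P := by
        refine setIntegral_mono_on (integrable_const _).integrableOn (iX 0).integrableOn
          (mD 0).compl fun ω hω ↦ ?_
        simpa [hD] using hω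
      simpa [mul_comm] using this
    | succ n ih =>
      have hsub : D (n + 1) ⊆ D n := fun ω hω i hi ↦ hω i (by omega)
      have hsplit : (D (n + 1))ᶜ = (D n)ᶜ ∪ (D n \ D (n + 1)) := by
        ext ω
        by_cases h1 : ω ∈ D n
        · simp [h1]
        · simpa [h1] using fun h2 ↦ h1 (hsub h2)
      have hdisj : Disjoint (D n)ᶜ (D n \ D (n + 1)) :=
        Set.disjoint_left.2 fun ω h1 h2 ↦ h1 h2.1
      have hmd := (mD n).diff (mD (n + 1))
      -- The increment is centred both on `D n` and on the whole space, hence on the complement.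
      have h1 : ∫ ω in (D n)ᶜ, X (n + 1) ω ∂P = ∫ ω in (D n)ᶜ, X n ω ∂P := by
        have := hincr n
        rw [integral_sub (iX _).integrableOn (iX _).integrableOn] at this
        rw [hcompl _ _ (mD n), hcompl _ _ (mD n)]
        linarith
      have h2 : h * P.real (D n \ D (n + 1)) ≤ ∫ ω in D n \ D (n + 1), X (n + 1) ω ∂P := by
        have : ∫ _ in D n \ D (n + 1), h ∂P ≤ ∫ ω in D n \ D (n + 1), X (n + 1) ω ∂P := by
          refine setIntegral_mono_on (integrable_const _).integrableOn (iX _).integrableOn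
            hmd fun ω hω ↦ ?_
          by_contra! hlt
          refine hω.2 fun i hi ↦ ?_
          rcases Nat.lt_or_ge n i with hni | hni
          · obtain rfl : i = n + 1 := by omega
            exact hlt
          · exact hω.1 i hni
        simpa [mul_comm] using this
      rw [hsplit, measureReal_union hdisj hmd,
        setIntegral_union hdisj hmd (iX _).integrableOn (iX _).integrableOn, h1]
      linarith
  have hfin : h * P.real (D n)ᶜ ≤ ∫ ω in D n, ‖X n ω‖ ∂P := by
    refine (key n).trans ?_
    rw [hcompl _ _ (mD n), ← integral_neg]
    exact integral_mono (iX n).neg.integrableOn (iX n).norm.integrableOn fun ω ↦ neg_le_abs _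
  have := ENNReal.ofReal_le_ofReal hfin
  rw [ofReal_integral_norm_eq_lintegral_enorm (iX n).integrableOn] at this
  refine le_trans (le_of_eq ?_) this
  rw [ENNReal.ofReal_mul' measureReal_nonneg, ofReal_measureReal]

end Domination

/-! ### First moments and the Markov property at a fixed time -/

section SampledBM

variable {Ω ι : Type*} [MeasurableSpace Ω] [AddCommMonoid ι] {c : ι →+ ℝ≥0} {B : ι → Ω → ℝ} {P : Measure Ω}

namespace IsSampledBM

theorem integral_sq (hB : IsSampledBM c B P) (t : ι) : ∫ ω, B t ω ^ 2 ∂P = c t := by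
  have := hB.isProbabilityMeasure
  have h := covariance_self (hB.measurable t).aemeasurable (μ := P)
  rw [hB.cov, min_self, variance_eq_sub (hB.memLp_two t), hB.mean] at h
  simpa using h.symm

theorem lintegral_enorm_le (hB : IsSampledBM c B P) (t : ι) {v : ℝ≥0} (hv : 0 < v)
    (h : c t ≤ v ^ 2) : ∫⁻ ω, ‖B t ω‖ₑ ∂P ≤ v := by
  have := hB.isProbabilityMeasure
  rw [← ofReal_integral_norm_eq_lintegral_enorm (hB.integrable t)]
  rw [← ENNReal.ofReal_coe_nnreal]
  apply ENNReal.ofReal_le_ofReal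
  have hv' : (0 : ℝ) < v := hv
  -- This is `|x| ≤ x ^ 2 / (2 v) + v / 2`, that is `(|x| - v) ^ 2 ≥ 0`.
  have hle : ∫ ω, ‖B t ω‖ ∂P ≤ ∫ ω, (B t ω ^ 2 / (2 * v) + v / 2) ∂P := by
    refine integral_mono (hB.integrable t).norm
      (((hB.memLp_two t).integrable_sq.div_const _).add (integrable_const _)) fun ω ↦ ?_
    simp only [Real.norm_eq_abs]
    rw [← sq_abs, div_add_div _ _ (by positivity) (by norm_num), le_div_iff₀ (by positivity)]
    nlinarith [sq_nonneg (|B t ω| - v)]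
  refine hle.trans ?_
  rw [integral_add ((hB.memLp_two t).integrable_sq.div_const _) (integrable_const _),
    integral_div, hB.integral_sq]
  have h' : (c t : ℝ) ≤ v ^ 2 := by exact_mod_cast h
  simp only [integral_const, probReal_univ, one_smul]
  rw [div_add_div _ _ (by positivity) (by norm_num), div_le_iff₀ (by positivity)]
  nlinarith

variable [LinearOrder ι] [CanonicallyOrderedAdd ι]

/-- A function of the past of `t₀` and a function of the increments after `t₀` decouple. -/
theorem setLIntegral_shift (hB : IsSampledBM c B P) (t₀ : ι) {E : Set (Set.Iic t₀ → ℝ)}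
    (hE : MeasurableSet E) {φ : (ι → ℝ) → ℝ≥0∞} (hφ : Measurable φ) :
    ∫⁻ ω in {ω | (fun t : Set.Iic t₀ ↦ B t ω) ∈ E}, φ (fun t ↦ B (t₀ + t) ω - B t₀ ω) ∂P =
      P {ω | (fun t : Set.Iic t₀ ↦ B t ω) ∈ E} * ∫⁻ ω, φ (fun t ↦ B t ω) ∂P := by
  have mpast : Measurable (fun ω (t : Set.Iic t₀) ↦ B t ω) :=
    measurable_pi_lambda _ fun t ↦ hB.measurable t
  have mshift := (hB.shift t₀).measurable_path
  have mE : MeasurableSet {ω | (fun t : Set.Iic t₀ ↦ B t ω) ∈ E} := mpast hE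
  have h1 := (hB.indepFun_shift t₀).comp hφ (measurable_one.indicator hE : Measurable
    (E.indicator (1 : (Set.Iic t₀ → ℝ) → ℝ≥0∞)))
  have h2 := lintegral_mul_eq_lintegral_mul_lintegral_of_indepFun (hφ.comp mshift)
    ((measurable_one.indicator hE).comp mpast) h1
  have h3 : ∫⁻ ω, φ (fun t ↦ B (t₀ + t) ω - B t₀ ω) ∂P = ∫⁻ ω, φ (fun t ↦ B t ω) ∂P := by
    rw [← lintegral_map hφ mshift, hB.map_shift, lintegral_map hφ hB.measurable_path]
  rw [← lintegral_indicator mE]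
  have h4 : ∫⁻ ω, ((E.indicator (1 : (Set.Iic t₀ → ℝ) → ℝ≥0∞)) ∘
      fun ω (t : Set.Iic t₀) ↦ B t ω) ω ∂P = P {ω | (fun t : Set.Iic t₀ ↦ B t ω) ∈ E} := by
    rw [← lintegral_indicator_one mE]
    rfl
  rw [h4, show (∫⁻ ω, (φ ∘ fun ω t ↦ B (t₀ + t) ω - B t₀ ω) ω ∂P) = _ from h3] at h2
  rw [mul_comm, ← h2]
  refine lintegral_congr fun ω ↦ ?_
  by_cases hω : (fun t : Set.Iic t₀ ↦ B t ω) ∈ E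
  · simp [hω]
  · simp [hω]

/-- Increments after `t₀` are centred on events of the past of `t₀`. -/
theorem setIntegral_increment (hB : IsSampledBM c B P) (t₀ u : ι) {E : Set (Set.Iic t₀ → ℝ)}
    (hE : MeasurableSet E) :
    ∫ ω in {ω | (fun t : Set.Iic t₀ ↦ B t ω) ∈ E}, (B (t₀ + u) ω - B t₀ ω) ∂P = 0 := by
  have mpast : Measurable (fun ω (t : Set.Iic t₀) ↦ B t ω) :=
    measurable_pi_lambda _ fun t ↦ hB.measurable t
  have mshift := (hB.shift t₀).measurable_path
  have h1 := (hB.indepFun_shift t₀).comp (measurable_pi_apply u) measurable_id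
  have h2 := Indep.setIntegral_eq_mul (A := {ω | (fun t : Set.Iic t₀ ↦ B t ω) ∈ E})
    (f := id) mpast.comap_le h1.symm ((hB.shift t₀).measurable u).aemeasurable ⟨E, hE, rfl⟩
    measurable_id.aestronglyMeasurable
  exact h2.trans (mul_eq_zero_of_right _ ((hB.shift t₀).mean u))

/-- The discretized optional stopping inequality on the grid `i • u`. -/
theorem mul_prob_crossing_grid_le (hB : IsSampledBM c B P) (u : ι) (h : ℝ) (n : ℕ) :
    ENNReal.ofReal h * P {ω | ∀ i ≤ n, B (i • u) ω < h}ᶜ ≤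
      ∫⁻ ω in {ω | ∀ i ≤ n, B (i • u) ω < h}, ‖B (n • u) ω‖ₑ ∂P := by
  have := hB.isProbabilityMeasure
  refine mul_prob_crossing_le (X := fun i ↦ B (i • u)) (fun i ↦ hB.measurable _)
    (fun i ↦ hB.integrable _) (fun i ↦ hB.mean _) h (fun k ↦ ?_) n
  have hmem : ∀ i ≤ k, i • u ≤ k • u := fun i hi ↦ by
    obtain ⟨j, rfl⟩ := Nat.exists_eq_add_of_le hi
    rw [add_smul]
    exact le_self_add
  let E : Set (Set.Iic (k • u) → ℝ) := {x | ∀ i (hi : i ≤ k), x ⟨i • u, hmem i hi⟩ < h}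
  have hE : MeasurableSet E := by
    simp only [E, Set.ofPred_forall]
    exact .iInter fun i ↦ .iInter fun hi ↦ measurableSet_lt (measurable_pi_apply _) measurable_const
  have := hB.setIntegral_increment (k • u) u hE
  rw [← succ_nsmul] at this
  exact this

end IsSampledBM

end SampledBM

/-! ### Loss functions and deviations with infinite values -/

section Functionals

theorem extendTop_mono {f : ℝ≥0 → ℝ≥0} (hf : Monotone f) : Monotone (extendTop f) := by
  intro x y hxy
  unfold extendTop
  by_cases hy : y = ∞
  · rw [if_pos hy]
    split_ifs with hx
    · exact le_rfl
    · exact le_iSup (fun z : ℝ≥0 ↦ (f z : ℝ≥0∞)) _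
  · have hx : x ≠ ∞ := ne_top_of_le_ne_top hy hxy
    rw [if_neg hy, if_neg hx]
    exact_mod_cast hf (ENNReal.toNNReal_mono hy hxy)

theorem extendTop_rpow {r : ℝ} (hr : 0 < r) (x : ℝ≥0∞) :
    extendTop (fun y ↦ y ^ r) x = x ^ r := by
  unfold extendTop
  split_ifs with hx
  · rw [hx, ENNReal.top_rpow_of_pos hr, iSup_eq_top]
    intro b hb
    lift b to ℝ≥0 using hb.ne
    refine ⟨(b + 1) ^ r⁻¹, ?_⟩
    simp only [← NNReal.rpow_mul, inv_mul_cancel₀ hr.ne', NNReal.rpow_one]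
    exact_mod_cast lt_add_one b
  · lift x to ℝ≥0 using hx
    rw [ENNReal.toNNReal_coe, ENNReal.coe_rpow_of_nonneg _ hr.le]

theorem measurable_deviation : Measurable fun p : ℝ≥0∞ × EReal ↦ deviation p.1 p.2 := by
  have habs : Measurable EReal.abs :=
    EReal.measurable_of_measurable_real (by
      simp only [EReal.abs_def]
      exact ENNReal.measurable_ofReal.comp measurable_abs)
  unfold deviation
  simp only [sub_eq_add_neg]
  exact habs.comp ((measurable_coe_ennreal_ereal.comp measurable_fst).add
    (continuous_neg.measurable.comp measurable_snd))

/-- Two deviations from the same estimate cannot both be small. -/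
theorem half_sub_le_max_deviation (a b : ℝ≥0∞) (e : EReal) :
    (b - a) / 2 ≤ max (deviation b e) (deviation a e) := by
  induction e with
  | bot =>
    have : deviation b ⊥ = ∞ := by
      unfold deviation
      rw [EReal.sub_bot (by simp)]
      rfl
    simp [this]
  | top =>
    have : deviation b ⊤ = ∞ := by
      unfold deviation
      -- In `EReal` also `⊤ - ⊤ = ⊥`, so this deviation is infinite even if `b = ∞`.
      rw [EReal.sub_top]
      rfl
    simp [this]
  | coe e =>
    by_cases hb : b = ∞
    · have : deviation b e = ∞ := by
        unfold deviation
        rw [hb, EReal.coe_ennreal_top, EReal.top_sub_coe]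
        rfl
      simp [this]
    by_cases ha : a = ∞
    · simp [ha]
    lift a to ℝ≥0 using ha
    lift b to ℝ≥0 using hb
    have key : ∀ x : ℝ≥0, deviation x e = ENNReal.ofReal |(x : ℝ) - e| := by
      intro x
      unfold deviation
      rw [← EReal.abs_def]
      rfl
    rw [key, key, ← ENNReal.ofReal_max, ← ENNReal.ofReal_coe_nnreal, ← ENNReal.ofReal_coe_nnreal,
      ← ENNReal.ofReal_sub _ a.coe_nonneg, ← ENNReal.ofReal_ofNat 2, ← ENNReal.ofReal_div_of_pos two_pos]
    apply ENNReal.ofReal_le_ofReal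
    rcases le_total |(b : ℝ) - e| |(a : ℝ) - e| with h | h
    · rw [max_eq_right h]
      linarith [le_abs_self ((b : ℝ) - e), neg_le_abs ((a : ℝ) - e)]
    · rw [max_eq_left h]
      linarith [le_abs_self ((b : ℝ) - e), neg_le_abs ((a : ℝ) - e)]

end Functionals

/-! ### Crossing times of deterministic paths -/

section Hitting

variable {ι : Type*}

/-- The first time, read on the clock `c`, at which the path `x` reaches the level `l`. -/
def hit (c : ι → ℝ≥0) (l : ℝ) (x : ι → ℝ) : ℝ≥0∞ :=
  ⨅ (t : ι) (_ : l ≤ x t), (c t : ℝ≥0∞)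

theorem hit_le {c : ι → ℝ≥0} {l : ℝ} {x : ι → ℝ} {t : ι} (h : l ≤ x t) : hit c l x ≤ c t :=
  iInf₂_le t h

theorem hit_mono {c : ι → ℝ≥0} {l l' : ℝ} (h : l ≤ l') (x : ι → ℝ) : hit c l x ≤ hit c l' x :=
  le_iInf₂ fun _ ht ↦ hit_le (h.trans ht)

variable [AddCommMonoid ι] {c : ι →+ ℝ≥0}

theorem le_hit_of_forall_lt [LinearOrder ι] [CanonicallyOrderedAdd ι] {l : ℝ} {x : ι → ℝ} {t₀ : ι}
    (h : ∀ s ≤ t₀, x s < l) : (c t₀ : ℝ≥0∞) ≤ hit c l x := by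
  refine le_iInf₂ fun t ht ↦ ?_
  rcases le_total t t₀ with hle | hle
  · exact absurd ht (h t hle).not_ge
  · exact_mod_cast clock_mono hle

/-- A path at or below `-d` at time `t₀` still has to climb at least `a + d`. The separate level
`a₀` lets one dip event, chosen for a low level, serve all higher ones. -/
theorem add_hit_shift_le [LinearOrder ι] [CanonicallyOrderedAdd ι] {a a₀ d : ℝ} {x : ι → ℝ} {t₀ : ι}
    (hx : x t₀ ≤ -d) (h : ∀ s ≤ t₀, x s < a₀) (ha : a₀ ≤ a) :
    c t₀ + hit c (a + d) (fun t ↦ x (t₀ + t) - x t₀) ≤ hit c a x := by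
  refine le_iInf₂ fun t ht ↦ ?_
  rcases le_total t t₀ with hle | hle
  · exact absurd (ha.trans ht) (h t hle).not_ge
  · obtain ⟨u, rfl⟩ := exists_add_of_le hle
    rw [map_add, ENNReal.coe_add]
    gcongr
    exact hit_le (by linarith)

/-- A space of paths that is stable under restarting and on which crossing times are measurable. -/
structure IsPathSpace (c : ι →+ ℝ≥0) (G : Submodule ℝ (ι → ℝ)) : Prop where
  shift_mem : ∀ x ∈ G, ∀ t₀, (fun t ↦ x (t₀ + t) - x t₀) ∈ G
  exists_measurable : ∀ l, 0 < l → ∃ T : (ι → ℝ) → ℝ≥0∞, Measurable T ∧ ∀ x ∈ G, T x = hit c l x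

end Hitting

/-! ### The reflection argument -/

section Estimation

variable {ι : Type*} [AddCommMonoid ι]
  {Ω : Type*} [MeasurableSpace Ω] {c : ι →+ ℝ≥0} {G : Submodule ℝ (ι → ℝ)} {B N : ι → Ω → ℝ}
  {P : Measure Ω}

theorem IsSampledBM.prob_mem (hB : IsSampledBM c B P) {s : Set ℝ} (hs : MeasurableSet s) (t : ι) :
    P {ω | B t ω ∈ s} = gaussianReal 0 (c t) s := by
  have := hB.isProbabilityMeasure
  have h := (hB.gaussian.hasGaussianLaw_eval t).map_eq_gaussianReal
  rw [← covariance_self (hB.measurable t).aemeasurable, hB.cov, min_self, hB.mean,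
    Real.toNNReal_coe] at h
  rw [← h, Measure.map_apply (hB.measurable t) hs]
  rfl

theorem IsSampledBM.prob_mem_ne_zero (hB : IsSampledBM c B P) {s : Set ℝ} (hs : MeasurableSet s)
    (hs' : volume s ≠ 0) {t : ι} (ht : 0 < c t) : P {ω | B t ω ∈ s} ≠ 0 := by
  rw [hB.prob_mem hs]
  exact fun h ↦ hs' (gaussianReal_absolutelyContinuous' 0 ht.ne' h)

variable [LinearOrder ι] [CanonicallyOrderedAdd ι]

/-- With positive probability the process stays below any given positive level for some time, and
is negative at the end. -/
def DipsBelow (c : ι →+ ℝ≥0) (G : Submodule ℝ (ι → ℝ)) (B : ι → Ω → ℝ) (P : Measure Ω) : Prop :=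
  ∀ a, 0 < a → ∃ (t₀ : ι) (d : ℝ) (E : Set (Set.Iic t₀ → ℝ)), 0 < c t₀ ∧ 0 < d ∧ MeasurableSet E ∧
    P {ω | (fun t : Set.Iic t₀ ↦ B t ω) ∈ E} ≠ 0 ∧
    ∀ x ∈ G, (fun t : Set.Iic t₀ ↦ x t) ∈ E → x t₀ ≤ -d ∧ ∀ s ≤ t₀, x s < a

/-- With uncountably many times, `hit` need not be measurable for the product σ-algebra. The
measurable `T` agrees with it on `G`, which almost surely contains the path and its restarts. -/
theorem setLIntegral_hit_shift (hG : IsPathSpace c G) (hB : IsSampledBM c B P)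
    (hBG : ∀ᵐ ω ∂P, (fun t ↦ B t ω) ∈ G) {l : ℝ} (hl : 0 < l) {φ : ℝ≥0∞ → ℝ≥0∞}
    (hφ : Measurable φ) (t₀ : ι) {E : Set (Set.Iic t₀ → ℝ)} (hE : MeasurableSet E) :
    ∫⁻ ω in {ω | (fun t : Set.Iic t₀ ↦ B t ω) ∈ E},
        φ (hit c l fun t ↦ B (t₀ + t) ω - B t₀ ω) ∂P =
      P {ω | (fun t : Set.Iic t₀ ↦ B t ω) ∈ E} * ∫⁻ ω, φ (hit c l fun t ↦ B t ω) ∂P := by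
  obtain ⟨T, mT, hT⟩ := hG.exists_measurable l hl
  have h1 : ∫⁻ ω, φ (hit c l fun t ↦ B t ω) ∂P = ∫⁻ ω, φ (T fun t ↦ B t ω) ∂P :=
    lintegral_congr_ae (by filter_upwards [hBG] with ω hω; rw [hT _ hω])
  have h2 := hB.setLIntegral_shift t₀ hE (hφ.comp mT)
  rw [h1]
  refine Eq.trans ?_ h2
  refine lintegral_congr_ae (ae_restrict_of_ae ?_)
  filter_upwards [hBG] with ω hω
  simp only [Function.comp_apply]
  rw [hT _ (hG.shift_mem _ hω t₀)]

/-- Infiniteness of the expected value of a monotone function of the crossing time does not depend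
on the level. -/
theorem lintegral_hit_eq_top (hG : IsPathSpace c G) (hB : IsSampledBM c B P)
    (hBG : ∀ᵐ ω ∂P, (fun t ↦ B t ω) ∈ G) (hdip : DipsBelow c G B P) {φ : ℝ≥0∞ → ℝ≥0∞}
    (hφ : Monotone φ) {h : ℝ} (hh : ∫⁻ ω, φ (hit c h fun t ↦ B t ω) ∂P = ∞) {a : ℝ} (ha : 0 < a) :
    ∫⁻ ω, φ (hit c a fun t ↦ B t ω) ∂P = ∞ := by
  obtain ⟨t₀, d, E, ht₀, hd, hE, hPE, hdip⟩ := hdip a ha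
  -- The dip event is chosen once, for the lowest level `a`; the gain `d` is thus the same at every
  -- step, and finitely many steps lead from above `h` down to `a`.
  have step : ∀ b, a ≤ b → ∫⁻ ω, φ (hit c (b + d) fun t ↦ B t ω) ∂P = ∞ →
      ∫⁻ ω, φ (hit c b fun t ↦ B t ω) ∂P = ∞ := by
    intro b hab hb
    have h1 := setLIntegral_hit_shift hG hB hBG (l := b + d) (by linarith) hφ.measurable t₀ hE
    rw [hb, ENNReal.mul_top hPE] at h1
    rw [eq_top_iff, ← h1]
    have mE : MeasurableSet {ω | (fun t : Set.Iic t₀ ↦ B t ω) ∈ E} :=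
      (measurable_pi_lambda _ fun t : Set.Iic t₀ ↦ hB.measurable t) hE
    refine le_trans ?_ (setLIntegral_le_lintegral {ω | (fun t : Set.Iic t₀ ↦ B t ω) ∈ E} _)
    refine lintegral_mono_ae ?_
    filter_upwards [ae_restrict_of_ae hBG, ae_restrict_mem mE] with ω hω hωE
    obtain ⟨hx, hs⟩ := hdip _ hω hωE
    have h2 := add_hit_shift_le (c := c) hx hs hab
    exact hφ (le_trans le_add_self h2)
  have main : ∀ n : ℕ, ∫⁻ ω, φ (hit c (a + n * d) fun t ↦ B t ω) ∂P = ∞ →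
      ∫⁻ ω, φ (hit c a fun t ↦ B t ω) ∂P = ∞ := by
    intro n
    induction n with
    | zero => simp
    | succ n ih =>
      intro hn
      refine ih (step _ ?_ ?_)
      · have : 0 ≤ n * d := by positivity
        linarith
      · rw [← hn]
        push_cast
        ring_nf
  obtain ⟨n, hn⟩ := exists_nat_gt ((h - a) / d)
  refine main n ?_
  rw [eq_top_iff, ← hh]
  refine lintegral_mono fun ω ↦ hφ (hit_mono ?_ _)
  rw [div_lt_iff₀ hd] at hn
  linarith

/-- The crossing times of two correlated copies are far apart. -/
theorem lintegral_hit_sub_hit_eq_top (hG : IsPathSpace c G) (hB : IsSampledBM c B P)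
    (hN : IsSampledBM c N P) (hBN : IndepFun (fun ω t ↦ B t ω) (fun ω t ↦ N t ω) P)
    (hBG : ∀ᵐ ω ∂P, (fun t ↦ B t ω) ∈ G) (hdip : DipsBelow c G B P) {φ : ℝ≥0∞ → ℝ≥0∞}
    (hφ : Monotone φ) {l : ℝ} (hl : 0 < l) (hφl : ∫⁻ ω, φ (hit c l fun t ↦ B t ω) ∂P = ∞)
    {a b : ℝ} (hb : 0 < b) :
    ∫⁻ ω, φ (hit c l (fun t ↦ B t ω) - hit c l fun t ↦ a * B t ω + b * N t ω) ∂P = ∞ := by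
  obtain ⟨t₀, d, E, ht₀, hd, hE, hPE, hdip⟩ := hdip l hl
  have mpast : Measurable fun ω (t : Set.Iic t₀) ↦ B t ω :=
    measurable_pi_lambda _ fun t ↦ hB.measurable t
  -- Bounding `|B t₀|` by `M` makes the requirement on the noise independent of `B`: `N t₀ ≥ K = (l
  -- + |a| * M) / b` forces `a * B t₀ + b * N t₀ ≥ l`.
  let E' : ℕ → Set (Set.Iic t₀ → ℝ) := fun M ↦ E ∩ {x | |x ⟨t₀, le_rfl⟩| ≤ M}
  have hE' : ∀ M, MeasurableSet (E' M) := fun M ↦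
    hE.inter (measurableSet_le (measurable_pi_apply _).abs measurable_const)
  obtain ⟨M, hM⟩ : ∃ M, P {ω | (fun t : Set.Iic t₀ ↦ B t ω) ∈ E' M} ≠ 0 := by
    by_contra! hzero
    refine hPE (measure_mono_null ?_ (measure_iUnion_null hzero))
    intro ω hω
    obtain ⟨M, hM⟩ := exists_nat_ge |B t₀ ω|
    exact Set.mem_iUnion.2 ⟨M, hω, hM⟩
  obtain ⟨T, mT, hT⟩ := hG.exists_measurable (l + d) (by linarith)
  let K : ℝ := (l + |a| * M) / b
  have mEN : MeasurableSet {ω | N t₀ ω ∈ Set.Ici K} := hN.measurable t₀ measurableSet_Ici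
  have mEB : MeasurableSet {ω | (fun t : Set.Iic t₀ ↦ B t ω) ∈ E' M} := mpast (hE' M)
  -- `ψ` sees only `B` and `χ` only `N`, so the mean of the product is `∞` times a positive
  -- probability.
  let ψ : (ι → ℝ) → ℝ≥0∞ := fun x ↦
    (E' M).indicator 1 (fun t : Set.Iic t₀ ↦ x t) * φ (T fun t ↦ x (t₀ + t) - x t₀)
  have mψ : Measurable ψ := by
    refine Measurable.mul ?_ (hφ.measurable.comp (mT.comp ?_))
    · exact (measurable_one.indicator (hE' M)).comp
        (measurable_pi_lambda _ fun t ↦ measurable_pi_apply _)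
    · exact measurable_pi_lambda _ fun t ↦ (measurable_pi_apply _).sub (measurable_pi_apply _)
  let χ : (ι → ℝ) → ℝ≥0∞ := fun x ↦ (Set.Ici K).indicator 1 (x t₀)
  have mχ : Measurable χ := (measurable_one.indicator measurableSet_Ici).comp (measurable_pi_apply t₀)
  have hprod := lintegral_mul_eq_lintegral_mul_lintegral_of_indepFun
    (mψ.comp hB.measurable_path) (mχ.comp hN.measurable_path) (hBN.comp mψ mχ)
  have hχ : ∫⁻ ω, (χ ∘ fun ω t ↦ N t ω) ω ∂P = P {ω | N t₀ ω ∈ Set.Ici K} := by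
    rw [← lintegral_indicator_one mEN]
    rfl
  have hψ : ∫⁻ ω, (ψ ∘ fun ω t ↦ B t ω) ω ∂P = ∞ := by
    have h1 := setLIntegral_hit_shift hG hB hBG (l := l + d) (by linarith) hφ.measurable t₀ (hE' M)
    have h2 : ∫⁻ ω, φ (hit c (l + d) fun t ↦ B t ω) ∂P = ∞ := by
      rw [eq_top_iff, ← hφl]
      exact lintegral_mono fun ω ↦ hφ (hit_mono (by linarith) _)
    rw [h2, ENNReal.mul_top hM, ← lintegral_indicator mEB] at h1
    rw [← h1]
    refine lintegral_congr_ae ?_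
    filter_upwards [hBG] with ω hω
    simp only [Function.comp_apply, ψ, hT _ (hG.shift_mem _ hω t₀)]
    by_cases hωE : (fun t : Set.Iic t₀ ↦ B t ω) ∈ E' M <;> simp [hωE]
  rw [hχ, hψ, ENNReal.top_mul
    (hN.prob_mem_ne_zero (measurableSet_Ici (a := K)) (by simp) ht₀)] at hprod
  rw [eq_top_iff, ← hprod]
  refine lintegral_mono_ae ?_
  filter_upwards [hBG] with ω hω
  simp only [Pi.mul_apply, Function.comp_apply, ψ, χ]
  by_cases hωE : (fun t : Set.Iic t₀ ↦ B t ω) ∈ E' M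
  swap
  · simp [hωE]
  by_cases hωN : K ≤ N t₀ ω
  swap
  · simp [hωN]
  rw [Set.indicator_of_mem hωE, Set.indicator_of_mem (Set.mem_Ici.2 hωN), Pi.one_apply,
    Pi.one_apply, one_mul, mul_one, hT _ (hG.shift_mem _ hω t₀)]
  obtain ⟨hx, hs⟩ := hdip _ hω hωE.1
  have h1 := add_hit_shift_le (c := c) hx hs le_rfl
  have hBM : |B t₀ ω| ≤ M := hωE.2
  have h2 : hit c l (fun t ↦ a * B t ω + b * N t ω) ≤ c t₀ := by
    refine hit_le ?_
    have hK : b * K = l + |a| * M := by simp only [K]; field_simp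
    have h3 : b * K ≤ b * N t₀ ω := by gcongr
    have h4 : |a * B t₀ ω| ≤ |a| * M := by rw [abs_mul]; gcongr
    linarith [neg_abs_le (a * B t₀ ω)]
  refine hφ (ENNReal.le_sub_of_add_le_left (ne_top_of_le_ne_top ENNReal.coe_ne_top h2) ?_)
  exact le_trans (by gcongr) h1

/-- No estimator can track the crossing time: its deviation has infinite expected loss. -/
theorem lintegral_deviation_eq_top (hG : IsPathSpace c G) (hB : IsSampledBM c B P)
    (hN : IsSampledBM c N P) (hBN : IndepFun (fun ω t ↦ B t ω) (fun ω t ↦ N t ω) P)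
    (hBG : ∀ᵐ ω ∂P, (fun t ↦ B t ω) ∈ G) (hNG : ∀ᵐ ω ∂P, (fun t ↦ N t ω) ∈ G)
    (hdip : DipsBelow c G B P) {f : ℝ≥0 → ℝ≥0} (hf : Monotone f) {l : ℝ} (hl : 0 < l)
    (hfl : ∫⁻ ω, extendTop f (hit c l (fun t ↦ B t ω) / 2) ∂P = ∞) {ε : ℝ} (hε : 0 < ε)
    {η : Ω → EReal} (hη : IsEstimator η (observation ε B N) P) :
    ∫⁻ ω, extendTop f (deviation (hit c l fun t ↦ B t ω) (η ω)) ∂P = ∞ := by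
  obtain ⟨g, mg, hg⟩ := hη
  obtain ⟨T, mT, hT⟩ := hG.exists_measurable l hl
  have hε2 : 0 < 1 + ε ^ 2 := by positivity
  -- The matrix with rows `(a, b)` and `(b, -a)` is the reflection in the line spanned by `(1, ε)`;
  -- `hY1` and `hY2` say that it fixes this vector.
  let a : ℝ := (1 - ε ^ 2) / (1 + ε ^ 2)
  let b : ℝ := 2 * ε / (1 + ε ^ 2)
  have hb : 0 < b := by positivity
  have hab : a ^ 2 + b ^ 2 = 1 := by simp only [a, b]; field_simp; ring
  have hY1 : a + ε * b = 1 := by simp only [a, b]; field_simp; ring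
  have hY2 : b + ε * -a = ε := by simp only [a, b]; field_simp; ring
  let B' : ι → Ω → ℝ := fun t ω ↦ a * B t ω + b * N t ω
  let N' : ι → Ω → ℝ := fun t ω ↦ b * B t ω + -a * N t ω
  have hY : ∀ ω, (fun t ↦ B' t ω + ε * N' t ω) = fun t ↦ B t ω + ε * N t ω := fun ω ↦ by
    funext t
    simp only [B', N']
    linear_combination B t ω * hY1 + N t ω * hY2
  have mB' : ∀ t, Measurable (B' t) := fun t ↦
    ((hB.measurable t).const_mul a).add ((hN.measurable t).const_mul b)
  have mN' : ∀ t, Measurable (N' t) := fun t ↦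
    ((hB.measurable t).const_mul b).add ((hN.measurable t).const_mul (-a))
  let Ψ : (ι → ℝ) × (ι → ℝ) → ℝ≥0∞ := fun p ↦
    extendTop f (deviation (T p.1) (g fun t ↦ p.1 t + ε * p.2 t))
  have mF := (extendTop_mono hf).measurable
  have mΨ : Measurable Ψ := by
    refine mF.comp (measurable_deviation.comp ((mT.comp measurable_fst).prodMk (mg.comp ?_)))
    fun_prop
  have hlaw : ∫⁻ ω, Ψ ((fun t ↦ B' t ω), fun t ↦ N' t ω) ∂P =
      ∫⁻ ω, Ψ ((fun t ↦ B t ω), fun t ↦ N t ω) ∂P := by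
    have := hB.map_reflect hN hBN hab
    rw [← lintegral_map (f := Ψ) mΨ ((measurable_pi_lambda _ mB').prodMk (measurable_pi_lambda _ mN')),
      ← lintegral_map (f := Ψ) mΨ (hB.measurable_path.prodMk hN.measurable_path)]
    exact congrArg (fun μ ↦ ∫⁻ p, Ψ p ∂μ) this
  have hdev : ∫⁻ ω, extendTop f (deviation (hit c l fun t ↦ B t ω) (η ω)) ∂P =
      ∫⁻ ω, Ψ ((fun t ↦ B t ω), fun t ↦ N t ω) ∂P := by
    refine lintegral_congr_ae ?_
    filter_upwards [hBG, hg] with ω hω hgω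
    rw [hgω, ← hT _ hω]
    rfl
  have hfar := lintegral_hit_sub_hit_eq_top hG hB hN hBN hBG hdip
    (φ := fun x ↦ extendTop f (x / 2))
    (fun x y hxy ↦ extendTop_mono hf (ENNReal.div_le_div_right hxy 2)) hl hfl (a := a) hb
  -- Both summands have the same mean by `hlaw`, so if their sum has infinite mean, each has.
  have hle : ∞ ≤ ∫⁻ ω, (Ψ ((fun t ↦ B t ω), fun t ↦ N t ω) +
      Ψ ((fun t ↦ B' t ω), fun t ↦ N' t ω)) ∂P := by
    rw [← hfar]
    refine lintegral_mono_ae ?_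
    filter_upwards [hBG, hNG] with ω hω hωN
    have hω' : (fun t ↦ B' t ω) ∈ G := G.add_mem (G.smul_mem a hω) (G.smul_mem b hωN)
    simp only [Ψ, hY, hT _ hω, hT _ hω']
    refine (extendTop_mono hf (half_sub_le_max_deviation _ _ (g fun t ↦ B t ω + ε * N t ω))).trans ?_
    rw [(extendTop_mono hf).map_max]
    exact max_le le_self_add le_add_self
  have mΨB : Measurable fun ω ↦ Ψ ((fun t ↦ B t ω), fun t ↦ N t ω) :=
    mΨ.comp (hB.measurable_path.prodMk hN.measurable_path)
  rw [lintegral_add_left mΨB, hlaw,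
    ← hdev, top_le_iff, ENNReal.add_eq_top, or_self] at hle
  exact hle

end Estimation

/-! ### Infinite moments of order at least one half -/

section SquareRoot

variable {ι : Type*} [AddCommMonoid ι] [LinearOrder ι] [CanonicallyOrderedAdd ι]
  {Ω : Type*} [MeasurableSpace Ω] {c : ι →+ ℝ≥0} {G : Submodule ℝ (ι → ℝ)} {B N : ι → Ω → ℝ}
  {P : Measure Ω}

/-- Crossing times have infinite moments of order `1 / 2`, given survival events satisfying the
optional stopping inequality. -/
theorem lintegral_sqrt_hit_eq_top (hB : IsSampledBM c B P) {u : ι} (hu : c u = 1)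
    {E : ∀ k : ℕ, Set (Set.Iic (4 ^ k • u) → ℝ)} (hE : ∀ k, MeasurableSet (E k))
    (hanti : Antitone fun k ↦ {ω | (fun t : Set.Iic (4 ^ k • u) ↦ B t ω) ∈ E k})
    {h : ℝ≥0∞} (hh : h ≠ 0)
    (hsurv : ∀ k, h * P {ω | (fun t : Set.Iic (4 ^ k • u) ↦ B t ω) ∈ E k}ᶜ ≤
      ∫⁻ ω in {ω | (fun t : Set.Iic (4 ^ k • u) ↦ B t ω) ∈ E k}, ‖B (4 ^ k • u) ω‖ₑ ∂P)
    {l : ℝ} (hl : ∀ᵐ ω ∂P, ∀ k, (fun t : Set.Iic (4 ^ k • u) ↦ B t ω) ∈ E k →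
      (4 : ℝ≥0∞) ^ k ≤ hit c l fun t ↦ B t ω) :
    ∫⁻ ω, (hit c l fun t ↦ B t ω) ^ (1 / 2 : ℝ) ∂P = ∞ := by
  have := hB.isProbabilityMeasure
  set D : ℕ → Set Ω := fun k ↦ {ω | (fun t : Set.Iic (4 ^ k • u) ↦ B t ω) ∈ E k}
  have mD : ∀ k, MeasurableSet (D k) := fun k ↦
    (measurable_pi_lambda _ fun t : Set.Iic (4 ^ k • u) ↦ hB.measurable t) (hE k)
  have hsum := tsum_survival_eq_top (P := P) (S := fun k ↦ B (4 ^ k • u)) (D := D) hh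
    (fun k ↦ hB.measurable _) mD hanti (hB.integrable _).2.ne (fun k ↦ ?_) hsurv
  · have h1 : ∑' k, 2 ^ k * P (D k) = ∫⁻ ω, ∑' k, (D k).indicator (fun _ ↦ (2 : ℝ≥0∞) ^ k) ω ∂P := by
      rw [lintegral_tsum fun k ↦ (measurable_const.indicator (mD k)).aemeasurable]
      refine tsum_congr fun k ↦ ?_
      rw [lintegral_indicator_const (mD k)]
    have h2 : ∫⁻ ω, ∑' k, (D k).indicator (fun _ ↦ (2 : ℝ≥0∞) ^ k) ω ∂P ≤
        ∫⁻ ω, 2 * (hit c l fun t ↦ B t ω) ^ (1 / 2 : ℝ) ∂P := by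
      refine lintegral_mono_ae ?_
      filter_upwards [hl] with ω hω
      exact tsum_indicator_le_sqrt (τ := fun ω ↦ hit c l fun t ↦ B t ω) hω
    rw [← h1, hsum, lintegral_const_mul' _ _ (by simp), top_le_iff, ENNReal.mul_eq_top] at h2
    simpa using h2
  · have hsplit : (4 ^ (k + 1) • u : ι) = 4 ^ k • u + (3 * 4 ^ k) • u := by
      rw [← add_smul]; congr 1; ring
    have h1 := hB.setLIntegral_shift (4 ^ k • u) (hE k)
      (φ := fun x ↦ ‖x ((3 * 4 ^ k) • u)‖ₑ) (measurable_pi_apply _).enorm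
    simp only [← hsplit] at h1
    refine h1.le.trans ?_
    -- The increment from `4 ^ k` to `4 ^ (k + 1)` has variance `3 * 4 ^ k ≤ (2 * 2 ^ k) ^ 2`.
    have h2 : ∫⁻ ω, ‖B ((3 * 4 ^ k) • u) ω‖ₑ ∂P ≤ ((2 * 2 ^ k : ℝ≥0) : ℝ≥0∞) := by
      refine hB.lintegral_enorm_le _ (by positivity) ?_
      rw [map_nsmul, hu, nsmul_one, mul_pow, ← pow_mul, mul_comm k 2, pow_mul]
      push_cast
      norm_num
    calc P (D k) * ∫⁻ ω, ‖B ((3 * 4 ^ k) • u) ω‖ₑ ∂P ≤ P (D k) * ((2 * 2 ^ k : ℝ≥0) : ℝ≥0∞) := by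
          gcongr
      _ = 2 * (2 ^ k * P (D k)) := by push_cast; ring

/-- Crossing times have infinite moments of any order at least `1 / 2`. -/
theorem lintegral_extendTop_rpow_hit_eq_top (hG : IsPathSpace c G) (hB : IsSampledBM c B P)
    (hBG : ∀ᵐ ω ∂P, (fun t ↦ B t ω) ∈ G) (hdip : DipsBelow c G B P) {l : ℝ}
    (hl : ∫⁻ ω, (hit c l fun t ↦ B t ω) ^ (1 / 2 : ℝ) ∂P = ∞) {r : ℝ} (hr : 1 / 2 ≤ r) {h : ℝ}
    (hh : 0 < h) :
    ∫⁻ ω, extendTop (fun x ↦ x ^ r) (hit c h (fun t ↦ B t ω) / 2) ∂P = ∞ := by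
  have := hB.isProbabilityMeasure
  have hr0 : 0 < r := by linarith
  simp only [extendTop_rpow hr0]
  refine lintegral_hit_eq_top hG hB hBG hdip (φ := fun x ↦ (x / 2) ^ r)
    (fun x y hxy ↦ ENNReal.rpow_le_rpow (ENNReal.div_le_div_right hxy 2) hr0.le) (h := l) ?_ hh
  -- With `y = x / 2`, `√y` is at most `1` for `y ≤ 1` and at most `y ^ r` for `y ≥ 1`.
  have hpt : ∀ x : ℝ≥0∞, x ^ (1 / 2 : ℝ) ≤ 2 ^ (1 / 2 : ℝ) * (1 + (x / 2) ^ r) := by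
    intro x
    have hx : x = 2 * (x / 2) := (ENNReal.mul_div_cancel (by simp) (by simp)).symm
    conv_lhs => rw [hx, ENNReal.mul_rpow_of_nonneg _ _ (by norm_num)]
    gcongr
    rcases le_total (x / 2) 1 with h1 | h1
    · exact le_add_right (ENNReal.rpow_le_one h1 (by norm_num))
    · exact le_add_left (ENNReal.rpow_le_rpow_of_exponent_le h1 hr)
  have hle := lintegral_mono (μ := P) fun ω ↦ hpt (hit c l fun t ↦ B t ω)
  have hc : (2 : ℝ≥0∞) ^ (1 / 2 : ℝ) ≠ ∞ := ENNReal.rpow_ne_top_of_nonneg (by norm_num) (by simp)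
  rw [hl, lintegral_const_mul' _ _ hc, lintegral_add_left measurable_const, top_le_iff,
    ENNReal.mul_eq_top] at hle
  simpa [hc] using hle

/-- Both parts of the tracking statement for a process observed in independent noise. -/
theorem tracking_of_sampledBM (hG : IsPathSpace c G) (hB : IsSampledBM c B P)
    (hN : IsSampledBM c N P) (hBN : IndepFun (fun ω t ↦ B t ω) (fun ω t ↦ N t ω) P)
    (hBG : ∀ᵐ ω ∂P, (fun t ↦ B t ω) ∈ G) (hNG : ∀ᵐ ω ∂P, (fun t ↦ N t ω) ∈ G)
    (hdip : DipsBelow c G B P) {l₀ : ℝ}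
    (hl₀ : ∫⁻ ω, (hit c l₀ fun t ↦ B t ω) ^ (1 / 2 : ℝ) ∂P = ∞) :
    (∀ f : ℝ≥0 → ℝ≥0, Monotone f →
      (∃ h : ℝ, 0 < h ∧ ∫⁻ ω, extendTop f (hit c h (fun t ↦ B t ω) / 2) ∂P = ∞) →
      ∀ ε l : ℝ, 0 < ε → 0 < l → ∀ η : Ω → EReal, IsEstimator η (observation ε B N) P →
        ∫⁻ ω, extendTop f (deviation (hit c l fun t ↦ B t ω) (η ω)) ∂P = ∞) ∧
    (∀ r : ℝ, 1 / 2 ≤ r →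
      (∀ h : ℝ, 0 < h →
        ∫⁻ ω, extendTop (fun x ↦ x ^ r) (hit c h (fun t ↦ B t ω) / 2) ∂P = ∞) ∧
      (∀ ε l : ℝ, 0 < ε → 0 < l → ∀ η : Ω → EReal, IsEstimator η (observation ε B N) P →
        ∫⁻ ω, deviation (hit c l fun t ↦ B t ω) (η ω) ^ r ∂P = ∞)) := by
  have main : ∀ f : ℝ≥0 → ℝ≥0, Monotone f →
      (∃ h : ℝ, 0 < h ∧ ∫⁻ ω, extendTop f (hit c h (fun t ↦ B t ω) / 2) ∂P = ∞) →
      ∀ ε l : ℝ, 0 < ε → 0 < l → ∀ η : Ω → EReal, IsEstimator η (observation ε B N) P →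
        ∫⁻ ω, extendTop f (deviation (hit c l fun t ↦ B t ω) (η ω)) ∂P = ∞ := by
    rintro f hf ⟨h, -, hfh⟩ ε l hε hl η hη
    refine lintegral_deviation_eq_top hG hB hN hBN hBG hNG hdip hf hl ?_ hε hη
    exact lintegral_hit_eq_top hG hB hBG hdip (φ := fun x ↦ extendTop f (x / 2))
      (fun x y hxy ↦ extendTop_mono hf (ENNReal.div_le_div_right hxy 2)) hfh hl
  refine ⟨main, fun r hr ↦ ?_⟩
  have hmom := fun h (hh : 0 < h) ↦
    lintegral_extendTop_rpow_hit_eq_top hG hB hBG hdip hl₀ hr hh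
  refine ⟨hmom, fun ε l hε hl η hη ↦ ?_⟩
  have hr0 : 0 < r := by linarith
  have := main (fun x ↦ x ^ r) (NNReal.monotone_rpow_of_nonneg hr0.le) ⟨1, one_pos, hmom 1 one_pos⟩
    ε l hε hl η hη
  simpa only [extendTop_rpow hr0] using this

end SquareRoot

/-! ### The Gaussian random walk -/

section RandomWalk

variable {Ω : Type*} [MeasurableSpace Ω] {V : ℕ → Ω → ℝ} {P : Measure Ω}

/-- The integer clock. -/
abbrev natClock : ℕ →+ ℝ≥0 := Nat.castAddMonoidHom ℝ≥0

theorem isPathSpace_natClock : IsPathSpace natClock ⊤ where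
  shift_mem _ _ _ := Submodule.mem_top
  exists_measurable l _ := by
    refine ⟨hit natClock l, ?_, fun _ _ ↦ rfl⟩
    refine Measurable.iInf fun t ↦ ?_
    classical
    have : (fun x : ℕ → ℝ ↦ ⨅ _ : l ≤ x t, (natClock t : ℝ≥0∞)) =
        fun x ↦ if l ≤ x t then (natClock t : ℝ≥0∞) else ∞ := by
      funext x
      split_ifs with h <;> simp [h]
    rw [this]
    exact Measurable.ite (measurableSet_le measurable_const (measurable_pi_apply t))
      measurable_const measurable_const

theorem isSampledBM_partialSum (mV : ∀ i, Measurable (V i))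
    (hV : ∀ i, HasLaw (V i) (gaussianReal 0 1) P) (iV : iIndepFun V P) :
    IsSampledBM natClock (partialSum V) P where
  measurable t := Finset.measurable_fun_sum _ fun i _ ↦ mV i
  gaussian := by
    have hg : IsGaussianProcess V P := ⟨fun I ↦
      iIndepFun.hasGaussianLaw (X := fun i : I ↦ V i) (fun i ↦ (hV i).hasGaussianLaw)
        (iV.precomp Subtype.val_injective)⟩
    refine hg.of_isGaussianProcess fun t ↦ ⟨Finset.range t,
      ∑ i, ContinuousLinearMap.proj (R := ℝ) (φ := fun _ : Finset.range t ↦ ℝ) i, fun ω ↦ ?_⟩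
    rw [sum_apply]
    exact (Finset.sum_coe_sort (Finset.range t) fun i ↦ V i ω).symm
  mean t := by
    simp only [partialSum]
    rw [integral_finsetSum _ fun i _ ↦ (hV i).hasGaussianLaw.integrable]
    refine Finset.sum_eq_zero fun i _ ↦ ?_
    rw [(hV i).integral_eq, integral_id_gaussianReal]
  cov s t := by
    have := iV.isProbabilityMeasure
    have hcov : ∀ i j, cov[V i, V j; P] = if i = j then 1 else 0 := by
      intro i j
      split_ifs with hij
      · subst hij
        rw [covariance_self (mV i).aemeasurable, (hV i).variance_eq, variance_id_gaussianReal]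
        rfl
      · exact (iV.indepFun hij).covariance_eq_zero (hV i).hasGaussianLaw.memLp_two
          (hV j).hasGaussianLaw.memLp_two
    have hsum : ∀ n, partialSum V n = ∑ i ∈ Finset.range n, V i := fun n ↦ by
      funext ω; simp [partialSum]
    rw [hsum, hsum, covariance_sum_sum' (fun i _ ↦ (hV i).hasGaussianLaw.memLp_two)
      (fun i _ ↦ (hV i).hasGaussianLaw.memLp_two)]
    simp only [hcov, Finset.sum_ite_eq, Finset.mem_range]
    rw [← Finset.sum_filter, Finset.sum_const, nsmul_one]
    have : (Finset.range s).filter (fun i ↦ i < t) = Finset.range (min s t) := by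
      ext i; simp
    rw [this, Finset.card_range]
    simp

theorem dipsBelow_partialSum (hB : IsSampledBM natClock (partialSum V) P) :
    DipsBelow natClock ⊤ (partialSum V) P := by
  intro a ha
  -- One step down to `-1` or lower is the dip. The condition at time `0` is part of `E` because
  -- paths in `⊤` need not start at `0`.
  let E : Set (Set.Iic 1 → ℝ) := {x | x ⟨1, Set.mem_Iic.2 le_rfl⟩ ≤ -1 ∧ x ⟨0, Set.mem_Iic.2 zero_le_one⟩ < a}
  refine ⟨1, 1, E, by simp, one_pos, ?_, ?_, ?_⟩
  · exact (measurableSet_le (measurable_pi_apply _) measurable_const).inter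
      (measurableSet_lt (measurable_pi_apply _) measurable_const)
  · have h := hB.prob_mem_ne_zero (measurableSet_Iic (a := (-1 : ℝ))) (by simp) (t := 1) (by simp)
    have hsub : {ω | partialSum V 1 ω ∈ Set.Iic (-1)} ⊆
        {ω | (fun t : Set.Iic 1 ↦ partialSum V t ω) ∈ E} := fun ω hω ↦
      ⟨hω, by simpa [partialSum] using ha⟩
    exact fun h0 ↦ h (measure_mono_null hsub h0)
  · rintro x - ⟨h1, h0⟩
    refine ⟨h1, fun s hs ↦ ?_⟩
    interval_cases s
    · exact h0
    · exact lt_of_le_of_lt h1 (by linarith)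

theorem lintegral_sqrt_hit_partialSum (hB : IsSampledBM natClock (partialSum V) P) :
    ∫⁻ ω, (hit natClock 1 fun t ↦ partialSum V t ω) ^ (1 / 2 : ℝ) ∂P = ∞ := by
  have hD : ∀ k : ℕ, {ω | (fun t : Set.Iic (4 ^ k • 1) ↦ partialSum V t ω) ∈ {x | ∀ t, x t < 1}} =
      {ω | ∀ i ≤ 4 ^ k, partialSum V (i • 1) ω < 1} := by
    intro k
    ext ω
    simp
  refine lintegral_sqrt_hit_eq_top hB (u := 1) (by simp) (E := fun _ ↦ {x | ∀ t, x t < 1})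
    (fun k ↦ ?_) ?_ one_ne_zero (fun k ↦ ?_) (ae_of_all _ fun ω k hω ↦ ?_)
  · rw [Set.ofPred_forall]
    exact .iInter fun t ↦ measurableSet_lt (measurable_pi_apply t) measurable_const
  · intro j k hjk ω hω
    simp only [hD] at hω ⊢
    exact fun i hi ↦ hω i (hi.trans (Nat.pow_le_pow_right (by norm_num) hjk))
  · rw [hD k, ← ENNReal.ofReal_one]
    exact hB.mul_prob_crossing_grid_le 1 1 (4 ^ k)
  · have h := le_hit_of_forall_lt (c := natClock) (l := 1) (x := fun t ↦ partialSum V t ω)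
      (t₀ := 4 ^ k • 1) fun s hs ↦ hω ⟨s, hs⟩
    simpa using h

end RandomWalk

/-! ### Measurability of crossing times of continuous paths -/

section DyadicTimes

open Filter Topology

/-- The `i`-th point of the grid of mesh `2 ^ (-m)`. -/
def dyadic (i m : ℕ) : ℝ≥0 := i / 2 ^ m

/-- Rounding down keeps the approximations at or before `t`, so bounds known only up to a time
horizon apply to them. -/
theorem exists_tendsto_dyadic (t : ℝ≥0) :
    ∃ i : ℕ → ℕ, (∀ m, dyadic (i m) m ≤ t) ∧ Tendsto (fun m ↦ dyadic (i m) m) atTop (𝓝 t) := by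
  have hle : ∀ m, dyadic ⌊t * 2 ^ m⌋₊ m ≤ t := fun m ↦
    div_le_of_le_mul₀ (by positivity) zero_le (Nat.floor_le zero_le)
  refine ⟨fun m ↦ ⌊t * 2 ^ m⌋₊, hle, ?_⟩
  · rw [← NNReal.tendsto_coe]
    have hlow : Tendsto (fun m : ℕ ↦ (t : ℝ) - (1 / 2) ^ m) atTop (𝓝 (t - 0)) :=
      tendsto_const_nhds.sub (tendsto_pow_atTop_nhds_zero_of_lt_one (by norm_num) (by norm_num))
    rw [sub_zero] at hlow
    refine tendsto_of_tendsto_of_tendsto_of_le_of_le hlow tendsto_const_nhds (fun m ↦ ?_) fun m ↦ ?_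
    · have h : t * 2 ^ m < ⌊t * 2 ^ m⌋₊ + 1 := Nat.lt_floor_add_one _
      have h' : (t : ℝ) * 2 ^ m < ⌊t * 2 ^ m⌋₊ + 1 := by exact_mod_cast h
      simp only [dyadic, NNReal.coe_div, NNReal.coe_natCast, NNReal.coe_pow, NNReal.coe_ofNat]
      rw [one_div, inv_pow, le_div_iff₀ (by positivity), sub_mul, inv_mul_cancel₀ (by positivity)]
      linarith
    · exact NNReal.coe_le_coe.2 (hle m)

/-- Upper bounds at dyadic times extend to all times, for continuous paths. -/
theorem le_of_forall_dyadic_le {x : ℝ≥0 → ℝ} (hx : Continuous x) {t₀ : ℝ≥0} {b : ℝ}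
    (h : ∀ i m, dyadic i m ≤ t₀ → x (dyadic i m) ≤ b) {t : ℝ≥0} (ht : t ≤ t₀) : x t ≤ b := by
  obtain ⟨i, hi, hlim⟩ := exists_tendsto_dyadic t
  exact le_of_tendsto' ((hx.tendsto t).comp hlim) fun m ↦ h _ _ ((hi m).trans ht)

/-- The continuous paths. -/
def continuousPaths : Submodule ℝ (ℝ≥0 → ℝ) where
  carrier := {x | Continuous x}
  add_mem' hx hy := hx.add hy
  zero_mem' := continuous_const
  smul_mem' a _ hx := hx.const_smul a

/-- The real clock. -/
abbrev realClock : ℝ≥0 →+ ℝ≥0 := AddMonoidHom.id ℝ≥0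

/-- A measurable functional that is the crossing time of `l` on continuous paths. -/
def dyadicHit (l : ℝ) (x : ℝ≥0 → ℝ) : ℝ≥0∞ :=
  ⨆ k : ℕ, ⨅ (i : ℕ) (m : ℕ) (_ : l - 1 / (k + 1) < x (dyadic i m)), (dyadic i m : ℝ≥0∞)

theorem measurable_dyadicHit (l : ℝ) : Measurable (dyadicHit l) := by
  refine Measurable.iSup fun k ↦ Measurable.iInf fun i ↦ Measurable.iInf fun m ↦ ?_
  classical
  have : (fun x : ℝ≥0 → ℝ ↦ ⨅ _ : l - 1 / (k + 1) < x (dyadic i m), (dyadic i m : ℝ≥0∞)) =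
      fun x ↦ if l - 1 / (k + 1) < x (dyadic i m) then (dyadic i m : ℝ≥0∞) else ∞ := by
    funext x
    split_ifs with h
    · exact iInf_pos h
    · exact iInf_neg h
  rw [this]
  exact Measurable.ite (measurableSet_lt measurable_const (measurable_pi_apply _))
    measurable_const measurable_const

/-- Dyadic times may miss the crossing itself, hence the relaxed levels `l - 1 / (k + 1)`: just
before a crossing some dyadic time exceeds each of them. Conversely, on a compact interval without a
crossing the maximum is below `l`, and for large `k` the relaxed level is out of reach there. -/
theorem dyadicHit_eq_hit {x : ℝ≥0 → ℝ} (hx : Continuous x) (l : ℝ) :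
    dyadicHit l x = hit realClock l x := by
  apply le_antisymm
  · refine iSup_le fun k ↦ le_iInf₂ fun t ht ↦ ?_
    obtain ⟨i, hi, hlim⟩ := exists_tendsto_dyadic t
    have hk : (0 : ℝ) < 1 / (k + 1) := by positivity
    have hlt : l - 1 / (k + 1) < x t := by linarith
    obtain ⟨m, hm⟩ := (((hx.tendsto t).comp hlim).eventually_const_lt hlt).exists
    exact (iInf_le_of_le (i m) (iInf_le_of_le m (iInf_le _ hm))).trans (by exact_mod_cast hi m)
  · by_contra! hlt
    obtain ⟨s, hs, hs'⟩ := exists_between hlt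
    lift s to ℝ≥0 using hs'.ne_top
    obtain ⟨y, hy, hmax⟩ := (isCompact_Icc (a := 0) (b := s)).exists_isMaxOn
      ⟨0, by simp⟩ hx.continuousOn
    have hyl : x y < l := by
      by_contra! hle
      have h1 : hit realClock l x ≤ y := hit_le hle
      exact absurd (h1.trans (by exact_mod_cast hy.2)) hs'.not_ge
    obtain ⟨k, hk⟩ := exists_nat_one_div_lt (sub_pos.2 hyl)
    refine absurd hs (not_lt.2 (le_iSup_of_le k ?_))
    refine le_iInf fun i ↦ le_iInf fun m ↦ le_iInf fun him ↦ ?_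
    by_contra! hlt'
    have hle : dyadic i m ≤ s := by exact_mod_cast hlt'.le
    have h1 : x (dyadic i m) ≤ x y := hmax (⟨zero_le, hle⟩ : dyadic i m ∈ Set.Icc 0 s)
    linarith

theorem isPathSpace_realClock : IsPathSpace realClock continuousPaths where
  shift_mem x hx t₀ := by
    have hx' : Continuous x := hx
    change Continuous fun t ↦ x (t₀ + t) - x t₀
    fun_prop
  exists_measurable l _ := ⟨dyadicHit l, measurable_dyadicHit l, fun _ hx ↦ dyadicHit_eq_hit hx l⟩

end DyadicTimes

/-! ### Brownian motion -/

section BrownianMotion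

open Filter Topology

variable {Ω : Type*} [MeasurableSpace Ω] {B : ℝ≥0 → Ω → ℝ} {P : Measure Ω}

theorem isSampledBM_of_isBrownianReal (mB : ∀ t, Measurable (B t)) (hB : IsBrownianReal B P) :
    IsSampledBM realClock B P where
  measurable := mB
  gaussian := hB.isGaussianProcess
  mean := hB.integral_eval
  cov s t := by rw [hB.covariance_eval]; simp

/-- Continuity at `0` confines the path for a short time. The confinement is two-sided so that it is
invariant under `B ↦ -B`; as `B t₀ ≠ 0` almost surely, a negative endpoint then has positive
probability. Testing dyadic times only keeps the events measurable. -/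
theorem dipsBelow_of_isBrownianReal (mB : ∀ t, Measurable (B t)) (hB : IsBrownianReal B P) :
    DipsBelow realClock continuousPaths B P := by
  intro a ha
  have hS := isSampledBM_of_isBrownianReal mB hB
  have := hS.isProbabilityMeasure
  -- Two-sided confinement up to a small time
  let F : ℝ≥0 → Set (ℝ≥0 → ℝ) := fun t₀ ↦ {x | ∀ i m, dyadic i m ≤ t₀ → |x (dyadic i m)| ≤ a / 2}
  have mF : ∀ t₀, MeasurableSet (F t₀) := fun t₀ ↦ by
    simp only [F, Set.ofPred_forall]
    exact .iInter fun i ↦ .iInter fun m ↦ .iInter fun _ ↦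
      measurableSet_le (measurable_pi_apply _).abs measurable_const
  obtain ⟨n, hn⟩ : ∃ n : ℕ, P {ω | (fun t ↦ B t ω) ∈ F (1 / (n + 1))} ≠ 0 := by
    by_contra! hzero
    have hnull := measure_iUnion_null hzero
    obtain ⟨ω, hω, hω'⟩ :=
      (hB.tendsto_nhds_zero.and (measure_eq_zero_iff_ae_notMem.1 hnull)).exists
    apply hω'
    have hball : ∀ᶠ t in 𝓝 (0 : ℝ≥0), |B t ω| < a / 2 := by
      have := hω.abs
      rw [abs_zero] at this
      exact this.eventually_lt_const (by positivity)
    obtain ⟨δ, hδ, hδB⟩ := Metric.eventually_nhds_iff.1 hball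
    obtain ⟨n, hn⟩ := exists_nat_one_div_lt hδ
    refine Set.mem_iUnion.2 ⟨n, fun i m him ↦ (hδB ?_).le⟩
    rw [NNReal.dist_eq, NNReal.coe_zero, sub_zero, abs_of_nonneg (NNReal.coe_nonneg _)]
    refine lt_of_le_of_lt ?_ hn
    exact_mod_cast him
  set t₀ : ℝ≥0 := 1 / (n + 1)
  have ht₀pos : 0 < t₀ := by positivity
  -- By symmetry, the confined path ends below zero with positive probability
  have hneg : P {ω | (fun t ↦ B t ω) ∈ F t₀ ∩ {x | x t₀ < 0}} ≠ 0 := by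
    intro h0
    have hlaw : P.map (fun ω t ↦ (-B) t ω) = P.map (fun ω t ↦ B t ω) := by
      have hS' := isSampledBM_of_isBrownianReal (B := -B) (fun t ↦ (mB t).neg) hB.neg
      exact map_eq_of_covariance_eq hS'.gaussian hS.gaussian hS'.measurable hS.measurable
        hS'.mean hS.mean fun s t ↦ by rw [hS.cov, hS'.cov]
    have mA : MeasurableSet (F t₀ ∩ {x | x t₀ < 0}) :=
      (mF t₀).inter (measurableSet_lt (measurable_pi_apply _) measurable_const)
    have h1 : P.map (fun ω t ↦ (-B) t ω) (F t₀ ∩ {x | x t₀ < 0}) =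
        P.map (fun ω t ↦ B t ω) (F t₀ ∩ {x | x t₀ < 0}) := by rw [hlaw]
    have mneg : Measurable fun ω t ↦ (-B) t ω := measurable_pi_lambda _ fun t ↦ (mB t).neg
    rw [Measure.map_apply mneg mA,
      Measure.map_apply hS.measurable_path mA] at h1
    have h2 : P {ω | B t₀ ω ∈ ({0} : Set ℝ)} = 0 := by
      rw [hS.prob_mem (measurableSet_singleton _)]
      have := nullSingletonClass_gaussianReal (μ := 0) (v := realClock t₀) ht₀pos.ne'
      exact measure_singleton 0
    refine hn (measure_mono_null (fun ω hω ↦ ?_)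
      (measure_union_null (measure_union_null h0 (h1.trans h0)) h2))
    rcases lt_trichotomy (B t₀ ω) 0 with h | h | h
    · exact Or.inl (Or.inl ⟨hω, h⟩)
    · exact Or.inr h
    · refine Or.inl (Or.inr ⟨fun i m him ↦ ?_, ?_⟩)
      · simpa using hω i m him
      · simpa using h
  obtain ⟨k, hk⟩ : ∃ k : ℕ,
      P {ω | (fun t ↦ B t ω) ∈ F t₀ ∩ {x | x t₀ ≤ -(1 / (k + 1))}} ≠ 0 := by
    by_contra! hzero
    refine hneg (measure_mono_null (fun ω hω ↦ ?_) (measure_iUnion_null hzero))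
    have hlt : 0 < -B t₀ ω := neg_pos.2 hω.2
    obtain ⟨k, hk⟩ := exists_nat_one_div_lt hlt
    exact Set.mem_iUnion.2 ⟨k, hω.1, by simp only [Set.mem_ofPred_eq]; linarith⟩
  let E : Set (Set.Iic t₀ → ℝ) :=
    {x | ∀ i m, ∀ h : dyadic i m ≤ t₀, |x ⟨dyadic i m, h⟩| ≤ a / 2} ∩
      {x | x ⟨t₀, Set.mem_Iic.2 le_rfl⟩ ≤ -(1 / (k + 1))}
  refine ⟨t₀, 1 / (k + 1), E, ht₀pos, by positivity, ?_, hk, ?_⟩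
  · refine MeasurableSet.inter ?_ (measurableSet_le (measurable_pi_apply _) measurable_const)
    simp only [Set.ofPred_forall]
    exact .iInter fun i ↦ .iInter fun m ↦ .iInter fun _ ↦
      measurableSet_le (measurable_pi_apply _).abs measurable_const
  · rintro x hx ⟨hxF, hxt⟩
    refine ⟨hxt, fun s hs ↦ ?_⟩
    have := le_of_forall_dyadic_le hx (fun i m him ↦ (abs_le.1 (hxF i m him)).2) hs
    linarith

/-- Optional stopping holds on each dyadic grid and passes to the limit as the grids are refined,
since the survival events decrease to survival at all dyadic times. -/
theorem lintegral_sqrt_hit_of_isBrownianReal (mB : ∀ t, Measurable (B t))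
    (hB : IsBrownianReal B P) :
    ∫⁻ ω, (hit realClock 2 fun t ↦ B t ω) ^ (1 / 2 : ℝ) ∂P = ∞ := by
  have hS := isSampledBM_of_isBrownianReal mB hB
  have := hS.isProbabilityMeasure
  refine lintegral_sqrt_hit_eq_top hS (u := 1) rfl
    (E := fun k ↦ {x | ∀ i m, ∀ h : dyadic i m ≤ 4 ^ k • 1, x ⟨dyadic i m, h⟩ < 1})
    (fun k ↦ ?_) ?_ one_ne_zero (fun k ↦ ?_) ?_
  · simp only [Set.ofPred_forall]
    exact .iInter fun i ↦ .iInter fun m ↦ .iInter fun _ ↦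
      measurableSet_lt (measurable_pi_apply _) measurable_const
  · intro j k hjk ω hω i m him
    refine hω i m (him.trans ?_)
    simp only [nsmul_one]
    exact_mod_cast Nat.pow_le_pow_right (by norm_num) hjk
  · let A : ℕ → Set Ω := fun m ↦ {ω | ∀ i ≤ 4 ^ k * 2 ^ m, B (i • dyadic 1 m) ω < 1}
    have hdy : ∀ i m, i • dyadic 1 m = dyadic i m := fun i m ↦ by
      simp [dyadic, div_eq_mul_inv]
    have hmem : ∀ i m, dyadic i m ≤ 4 ^ k • 1 ↔ i ≤ 4 ^ k * 2 ^ m := fun i m ↦ by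
      rw [dyadic, nsmul_one, div_le_iff₀ (by positivity)]
      exact_mod_cast Iff.rfl
    have mA : ∀ m, MeasurableSet (A m) := fun m ↦ by
      simp only [A, Set.ofPred_forall]
      exact .iInter fun i ↦ .iInter fun _ ↦ measurableSet_lt (mB _) measurable_const
    have hA : {ω | (fun t : Set.Iic (4 ^ k • 1 : ℝ≥0) ↦ B t ω) ∈
        {x | ∀ i m, ∀ h : dyadic i m ≤ 4 ^ k • 1, x ⟨dyadic i m, h⟩ < 1}} = ⋂ m, A m := by
      ext ω
      simp only [A, hdy, Set.mem_iInter, Set.mem_ofPred_eq, hmem]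
      exact forall_comm
    have hanti : Antitone A := antitone_nat_of_succ_le fun m ω hω i hi ↦ by
      have h2 : dyadic (2 * i) (m + 1) = dyadic i m := by
        simp only [dyadic, pow_succ']
        push_cast
        exact mul_div_mul_left _ _ two_ne_zero
      have := hω (2 * i) (by rw [pow_succ]; nlinarith)
      rwa [hdy, h2, ← hdy] at this
    rw [hA]
    have hsurv : ∀ m, 1 * (1 - P (A m)) ≤ ∫⁻ ω in A m, ‖B (4 ^ k • 1) ω‖ₑ ∂P := by
      intro m
      have h := hS.mul_prob_crossing_grid_le (dyadic 1 m) 1 (4 ^ k * 2 ^ m)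
      have hend : (4 ^ k * 2 ^ m) • dyadic 1 m = 4 ^ k • 1 := by
        rw [hdy, dyadic]
        push_cast
        rw [mul_div_cancel_right₀ _ (by positivity)]
        simp
      rw [hend, ENNReal.ofReal_one] at h
      rw [← prob_compl_eq_one_sub (mA m)]
      exact h
    -- Regarding the right-hand side as a finite measure, continuity from above gives the limit on
    -- both sides.
    let ν : Measure Ω := P.withDensity fun ω ↦ ‖B (4 ^ k • 1) ω‖ₑ
    have hν : IsFiniteMeasure ν := isFiniteMeasure_withDensity (hS.integrable _).2.ne
    have hνA : ∀ s, MeasurableSet s → ∫⁻ ω in s, ‖B (4 ^ k • 1) ω‖ₑ ∂P = ν s := fun s hs ↦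
      (withDensity_apply _ hs).symm
    have hlimP := tendsto_measure_iInter_atTop (μ := P) (fun m ↦ (mA m).nullMeasurableSet) hanti
      ⟨0, measure_ne_top _ _⟩
    have hlimν := tendsto_measure_iInter_atTop (μ := ν) (fun m ↦ (mA m).nullMeasurableSet) hanti
      ⟨0, measure_ne_top _ _⟩
    rw [prob_compl_eq_one_sub (.iInter mA), hνA _ (.iInter mA)]
    refine le_of_tendsto_of_tendsto' ?_ hlimν fun m ↦ (hsurv m).trans_eq (hνA _ (mA m))
    exact ENNReal.Tendsto.const_mul (ENNReal.Tendsto.sub tendsto_const_nhds hlimP (by simp))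
      (by simp)
  · filter_upwards [hB.cont] with ω hω k hE
    -- Values below `1` at dyadic times only give values at most `1` at all times, hence the
    -- crossing level `2`.
    have h := le_hit_of_forall_lt (c := realClock) (l := 2) (x := fun t ↦ B t ω)
      (t₀ := 4 ^ k • 1) fun s hs ↦
        (le_of_forall_dyadic_le hω (fun i m him ↦ (hE i m him).le) hs).trans_lt one_lt_two
    simpa using h

end BrownianMotion

end ThresholdTracking

end

theorem proposition1 {Ω : Type*} [MeasurableSpace Ω] (P : Measure Ω) [IsProbabilityMeasure P] :
    -- Gaussian random walk setting, drift `0`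
    (∀ V W : ℕ → Ω → ℝ, IsGaussianStepPair V W P →
      -- part i
      (∀ f : ℝ≥0 → ℝ≥0, Monotone f →
        (∃ h : ℝ, 0 < h ∧ ∫⁻ ω, extendTop f (crossingNat (walk 0 V) h ω / 2) ∂P = ∞) →
        ∀ ε l : ℝ, 0 < ε → 0 < l → ∀ η : Ω → EReal,
          IsEstimator η (observation ε (walk 0 V) (partialSum W)) P →
          ∫⁻ ω, extendTop f (deviation (crossingNat (walk 0 V) l ω) (η ω)) ∂P = ∞) ∧
      -- part ii
      (∀ r : ℝ, 1 / 2 ≤ r →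
        (∀ h : ℝ, 0 < h →
          ∫⁻ ω, extendTop (fun x ↦ x ^ r) (crossingNat (walk 0 V) h ω / 2) ∂P = ∞) ∧
        (∀ ε l : ℝ, 0 < ε → 0 < l → ∀ η : Ω → EReal,
          IsEstimator η (observation ε (walk 0 V) (partialSum W)) P →
          ∫⁻ ω, deviation (crossingNat (walk 0 V) l ω) (η ω) ^ r ∂P = ∞))) ∧
    -- Brownian motion setting, drift `0`
    (∀ B N : ℝ≥0 → Ω → ℝ, IsBrownianPair B N P →
      -- part i
      (∀ f : ℝ≥0 → ℝ≥0, Monotone f →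
        (∃ h : ℝ, 0 < h ∧ ∫⁻ ω, extendTop f (crossingReal (driftedBM 0 B) h ω / 2) ∂P = ∞) →
        ∀ ε l : ℝ, 0 < ε → 0 < l → ∀ η : Ω → EReal,
          IsEstimator η (observation ε (driftedBM 0 B) N) P →
          ∫⁻ ω, extendTop f (deviation (crossingReal (driftedBM 0 B) l ω) (η ω)) ∂P = ∞) ∧
      -- part ii
      (∀ r : ℝ, 1 / 2 ≤ r →
        (∀ h : ℝ, 0 < h →
          ∫⁻ ω, extendTop (fun x ↦ x ^ r) (crossingReal (driftedBM 0 B) h ω / 2) ∂P = ∞) ∧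
        (∀ ε l : ℝ, 0 < ε → 0 < l → ∀ η : Ω → EReal,
          IsEstimator η (observation ε (driftedBM 0 B) N) P →
          ∫⁻ ω, deviation (crossingReal (driftedBM 0 B) l ω) (η ω) ^ r ∂P = ∞))) := by
  constructor
  · intro V W h
    have hV := isSampledBM_partialSum h.measurable_left h.hasLaw_left h.indep_left
    have hW := isSampledBM_partialSum h.measurable_right h.hasLaw_right h.indep_right
    have hwalk : walk 0 V = partialSum V := by
      funext t ω
      simp [walk]
    have hcross : ∀ l ω, crossingNat (partialSum V) l ω =
        hit natClock l fun t ↦ partialSum V t ω := by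
      intro l ω
      simp [crossingNat, hit]
    have mS : Measurable fun (x : ℕ → ℝ) (t : ℕ) ↦ ∑ i ∈ Finset.range t, x i :=
      measurable_pi_lambda _ fun t ↦ Finset.measurable_fun_sum _ fun i _ ↦ measurable_pi_apply i
    have hind : IndepFun (fun ω t ↦ partialSum V t ω) (fun ω t ↦ partialSum W t ω) P :=
      h.indep.comp mS mS
    simp only [hwalk, hcross]
    exact tracking_of_sampledBM isPathSpace_natClock hV hW hind (ae_of_all _ fun _ ↦ trivial)
      (ae_of_all _ fun _ ↦ trivial) (dipsBelow_partialSum hV) (lintegral_sqrt_hit_partialSum hV)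
  · intro B N h
    have hB := isSampledBM_of_isBrownianReal h.measurable_left h.left
    have hN := isSampledBM_of_isBrownianReal h.measurable_right h.right
    have hdrift : driftedBM 0 B = B := by
      funext t ω
      simp [driftedBM]
    have hcross : ∀ l ω, crossingReal B l ω = hit realClock l fun t ↦ B t ω := fun _ _ ↦ rfl
    simp only [hdrift, hcross]
    exact tracking_of_sampledBM isPathSpace_realClock hB hN h.indep h.left.cont h.right.cont
      (dipsBelow_of_isBrownianReal h.measurable_left h.left)
      (lintegral_sqrt_hit_of_isBrownianReal h.measurable_left h.left)
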